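/- Let $C=\mathbb{C}$ and let $H^C=H\otimes_{\mathbb R} C$ be the complexified quaternions, with the $C$-linear conjugation $x\mapsto\overline{x}$ extending quaternion conjugation. Let $$J=(\mathfrak J_H)^C=\{X\in M_3(H^C)\mid {}^t\overline{X}=X\},$$ with unit matrix $E$, and put, for $X,Y\in J$, $X\circ Y=\frac12(XY+YX)$, $(X,Y)=\mathrm{tr}(X\circ Y)$, $X\times Y=\frac12\bigl(2X\circ Y-\mathrm{tr}(X)Y-\mathrm{tr}(Y)X+(\mathrm{tr}(X)\mathrm{tr}(Y)-(X,Y))E\bigr)$, and $(X,Y,Z)=(X,Y\times Z)$. For $X\in J$ let $\tilde X\in\mathrm{End}_C(J)$ be $\tilde XZ=X\circ Z$, and put $X\vee W=[\tilde X,\tilde W]+\bigl(X\circ W-\frac13(X,W)E\bigr)^{\sim}$. For $\phi\in\mathrm{End}_C(J)$ let ${}^t\phi$ be the transpose: $({}^t\phi X,Y)=(X,\phi Y)$. *The algebras $(\mathfrak f_{4,H})^C$ and $(\mathfrak e_{6,H})^C$.* Let $(\mathfrak f_{4,H})^C$ be the Lie algebra of derivations of $(J,\circ)$, with the bilinear form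 $(\delta_1,\delta_2)_4=\frac12\mathrm{tr}_J(\delta_1\delta_2)$, which is the unique bilinear form such that $(\delta,[\tilde A,\tilde B])_4=(\delta A,B)$ for all $\delta\in(\mathfrak f_{4,H})^C$ and $A,B\in J$. Let $(\mathfrak e_{6,H})^C=\{\phi\in\mathrm{End}_C(J)\mid(\phi X,X,X)=0\text{ for all }X\in J\}$. Each $\phi\in(\mathfrak e_{6,H})^C$ is uniquely $\phi=\delta+\tilde T$ with $\delta\in(\mathfrak f_{4,H})^C$, $T\in J$, $\mathrm{tr}(T)=0$; put $(\phi_1,\phi_2)_6=(\delta_1,\delta_2)_4+(T_1,T_2)$. *The algebra $(\mathfrak e_{7,H})^C$.* Let $\mathfrak P=(\mathfrak P_H)^C=J\oplus J\oplus C\oplus C$. For $P=(X,Y,\xi,\eta)$ and $Q=(Z,W,\zeta,\omega)$ in $\mathfrak P$ put $\{P,Q\}=(X,W)-(Y,Z)+\xi\omega-\eta\zeta$. For $\phi\in(\mathfrak e_{6,H})^C$, $A,B\in J$, $\nu\in C$ let $\Phi(\phi,A,B,\nu)\in\mathrm{End}_C(\mathfrak P)$ be $$(X,Y,\xi,\eta)\mapsto\bigl(\phi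 X-\tfrac13\nu X+2B\times Y+\eta A,\ 2A\times X-{}^t\phi Y+\tfrac13\nu Y+\xi B,\ (A,Y)+\nu\xi,\ (B,X)-\nu\eta\bigr).$$ These maps form a Lie algebra $(\mathfrak e_{7,H})^C$ under the commutator, and $\Phi(\phi,A,B,\nu)$ determines $\phi,A,B,\nu$. For $\Phi_i=\Phi(\phi_i,A_i,B_i,\nu_i)$ put $$(\Phi_1,\Phi_2)_7=-2(\phi_1,\phi_2)_6-4(A_1,B_2)-4(A_2,B_1)-\tfrac83\nu_1\nu_2 .$$ For $P,Q$ as above put $P\times Q=\Phi(\phi,A,B,\nu)\in(\mathfrak e_{7,H})^C$ with $\phi=-\frac12(X\vee W+Z\vee Y)$, $A=-\frac14(2Y\times W-\xi Z-\zeta X)$, $B=\frac14(2X\times Z-\eta W-\omega Y)$, $\nu=\frac18\bigl((X,W)+(Z,Y)-3(\xi\omega+\zeta\eta)\bigr)$. *The algebra $(\mathfrak e_{8,H})^C$.* Let $(\mathfrak e_{8,H})^C=(\mathfrak e_{7,H})^C\oplus\mathfrak P\oplus\mathfrak P\oplus C\oplus C\oplus C$, with elements $R=(\Phi,P,Q,r,s,t)$.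 It is a complex Lie algebra with bracket $[R_1,R_2]=(\Phi,P,Q,r,s,t)$, where $$\begin{aligned} \Phi&=[\Phi_1,\Phi_2]+P_1\times Q_2-P_2\times Q_1,\\ P&=\Phi_1P_2-\Phi_2P_1+r_1P_2-r_2P_1+s_1Q_2-s_2Q_1,\\ Q&=\Phi_1Q_2-\Phi_2Q_1-r_1Q_2+r_2Q_1+t_1P_2-t_2P_1,\\ r&=-\tfrac18\{P_1,Q_2\}+\tfrac18\{P_2,Q_1\}+s_1t_2-s_2t_1,\\ s&=\tfrac14\{P_1,P_2\}+2r_1s_2-2r_2s_1,\\ t&=-\tfrac14\{Q_1,Q_2\}-2r_1t_2+2r_2t_1 . \end{aligned}$$ Put $(R_1,R_2)_8=(\Phi_1,\Phi_2)_7-\{Q_1,P_2\}+\{P_1,Q_2\}-8r_1r_2-4t_1s_2-4s_1t_2$. **Theorem 8.1.** Let $B_{7,H}$ and $B_{8,H}$ be the Killing forms of $(\mathfrak e_{7,H})^C$ and $(\mathfrak e_{8,H})^C$. For all $R_i=(\Phi_i,P_i,Q_i,r_i,s_i,t_i)\in(\mathfrak e_{8,H})^C$, $i=1,2$, $$\begin{aligned}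 B_{8,H}(R_1,R_2)&=-9(R_1,R_2)_8\\ &=-9(\Phi_1,\Phi_2)_7+9\{Q_1,P_2\}-9\{P_1,Q_2\}+72r_1r_2+36t_1s_2+36s_1t_2\\ &=\tfrac95B_{7,H}(\Phi_1,\Phi_2)+9\{Q_1,P_2\}-9\{P_1,Q_2\}+72r_1r_2+36t_1s_2+36s_1t_2 . \end{aligned}$$ -/

import Mathlib

set_option linter.unusedSimpArgs false
open scoped Matrix

namespace QuatE8

/-- The complexification `H^C = H ⊗ C` of the quaternions, with basis `1, i, j, k` over `ℂ` and
`i² = j² = k² = -1`, `ij = k`. Its `star` is the `ℂ`-linear conjugation that negates `i, j, k`. -/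
abbrev HC : Type := QuaternionAlgebra ℂ (-1) 0 (-1)

theorem star_smulC (c : ℂ) (x : HC) : star (c • x) = c • star x := by
  ext <;> simp

theorem hm0 (x y : HC) : (x * y).re = x.re * y.re - x.imI * y.imI - x.imJ * y.imJ - x.imK * y.imK := by
  simp; ring

theorem hm1 (x y : HC) : (x * y).imI = x.re * y.imI + x.imI * y.re + x.imJ * y.imK - x.imK * y.imJ := by
  simp; ring

theorem hm2 (x y : HC) : (x * y).imJ = x.re * y.imJ - x.imI * y.imK + x.imJ * y.re + x.imK * y.imI := by
  simp; ring

theorem hm3 (x y : HC) : (x * y).imK = x.re * y.imK + x.imI * y.imJ - x.imJ * y.imI + x.imK * y.re := by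
  simp

theorem hs0 (x : HC) : (star x).re = x.re := by simp

theorem hs1 (x : HC) : (star x).imI = -x.imI := by simp

theorem hs2 (x : HC) : (star x).imJ = -x.imJ := by simp

theorem hs3 (x : HC) : (star x).imK = -x.imK := by simp

/-- The Jordan algebra `J(3, H^C)`: the `3 × 3` matrices `X` over `H^C` with `X* = X`, where `X*` is
the transpose of the (`ℂ`-linear) conjugate. -/
def JH : Submodule ℂ (Matrix (Fin 3) (Fin 3) HC) where
  carrier := {X | Xᴴ = X}
  add_mem' {X Y} hX hY := by
    have hX' : Xᴴ = X := hX
    have hY' : Yᴴ = Y := hY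
    change (X + Y)ᴴ = X + Y
    rw [Matrix.conjTranspose_add X Y, hX', hY']
  zero_mem' := Matrix.conjTranspose_zero
  smul_mem' c X hX := by
    have hX' : Xᴴ = X := hX
    change (c • X)ᴴ = c • X
    ext1 i j
    rw [Matrix.conjTranspose_apply, Matrix.smul_apply, star_smulC, ← Matrix.conjTranspose_apply, hX',
      Matrix.smul_apply]

theorem JH.star_apply (X : JH) (i j : Fin 3) : star (X.1 i j) = X.1 j i := by
  have h := congrFun (congrFun X.2 j) i
  simpa [Matrix.conjTranspose_apply] using h

/-- The trace `tr X`; it lies in `ℂ`, since the diagonal entries of `X` do (see `JH.diag`). -/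
def tr : JH →ₗ[ℂ] ℂ where
  toFun X := (Matrix.trace X.1).re
  map_add' X Y := by simp
  map_smul' c X := by simp

theorem jmul_mem (X Y : JH) : (1 / 2 : ℂ) • (X.1 * Y.1 + Y.1 * X.1) ∈ JH := by
  refine JH.smul_mem _ ?_
  have hX : (X.1)ᴴ = X.1 := X.2
  have hY : (Y.1)ᴴ = Y.1 := Y.2
  change (X.1 * Y.1 + Y.1 * X.1)ᴴ = _
  rw [Matrix.conjTranspose_add (X.1 * Y.1) (Y.1 * X.1), Matrix.conjTranspose_mul, Matrix.conjTranspose_mul, hX, hY, add_comm]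

/-- The Jordan product `X ∘ Y = (XY + YX) / 2`. -/
noncomputable def jmul : JH →ₗ[ℂ] JH →ₗ[ℂ] JH :=
  LinearMap.mk₂ ℂ (fun X Y => ⟨(1 / 2 : ℂ) • (X.1 * Y.1 + Y.1 * X.1), jmul_mem X Y⟩)
    (fun X Y Z => Subtype.ext (by simp [add_mul, mul_add]; module))
    (fun c X Y => Subtype.ext (by simp [← smul_add, smul_comm _ c]))
    (fun X Y Z => Subtype.ext (by simp [add_mul, mul_add]; module))
    (fun c X Y => Subtype.ext (by simp [← smul_add, smul_comm _ c]))

/-- The unit matrix. -/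
def E : JH := ⟨1, by change (1 : Matrix (Fin 3) (Fin 3) HC)ᴴ = 1; simp⟩

/-- The inner product `(X, Y) = tr (X ∘ Y)`. -/
noncomputable def ip : JH →ₗ[ℂ] JH →ₗ[ℂ] ℂ := jmul.compr₂ tr

/-- The Freudenthal multiplication
`X × Y = (2 X ∘ Y - tr(X) Y - tr(Y) X + (tr(X) tr(Y) - (X, Y)) E) / 2`. -/
noncomputable def cross : JH →ₗ[ℂ] JH →ₗ[ℂ] JH :=
  LinearMap.mk₂ ℂ (fun X Y => (1 / 2 : ℂ) • ((2 : ℂ) • jmul X Y - tr X • Y - tr Y • X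
      + (tr X * tr Y - ip X Y) • E))
    (fun X Y Z => by simp; module)
    (fun c X Y => by simp; module)
    (fun X Y Z => by simp; module)
    (fun c X Y => by simp; module)

/-- The diagonal entries. -/
def dg (i : Fin 3) (X : JH) : ℂ := (X.1 i i).re

theorem JH.diag (X : JH) (i : Fin 3) : X.1 i i = (dg i X : HC) := by
  have h := JH.star_apply X i i
  have h1 := congrArg QuaternionAlgebra.imI h
  have h2 := congrArg QuaternionAlgebra.imJ h
  have h3 := congrArg QuaternionAlgebra.imK h
  have key : ∀ z : ℂ, -z = z → z = 0 := fun z hz => by linear_combination (-1/2 : ℂ) * hz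
  ext
  · simp [dg]
  · simpa using key _ (by simpa using h1)
  · simpa using key _ (by simpa using h2)
  · simpa using key _ (by simpa using h3)

theorem JH.ext' {X Y : JH} (h0 : dg 0 X = dg 0 Y) (h1 : dg 1 X = dg 1 Y) (h2 : dg 2 X = dg 2 Y)
    (a1 : X.1 1 2 = Y.1 1 2) (a2 : X.1 2 0 = Y.1 2 0) (a3 : X.1 0 1 = Y.1 0 1) : X = Y := by
  apply Subtype.ext
  ext1 i j
  fin_cases i <;> fin_cases j <;> simp only [Fin.zero_eta, Fin.mk_one, Fin.reduceFinMk, JH.diag, h0, h1, h2, a1, a2, a3]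
  · rw [← JH.star_apply X, ← JH.star_apply Y, a2]
  · rw [← JH.star_apply X, ← JH.star_apply Y, a3]
  · rw [← JH.star_apply X, ← JH.star_apply Y, a1]


/-- The element of `J(3, H^C)` with given entries. -/
noncomputable def ofCoord (a b c : ℂ) (x y z : HC) : JH :=
  ⟨!![(a : HC), z, star y; star z, (b : HC), x; y, star x, (c : HC)], by
    change _ᴴ = _
    ext1 i j
    rw [Matrix.conjTranspose_apply]
    fin_cases i <;> fin_cases j <;> simp⟩

theorem exists_ofCoord (X : JH) : ∃ a b c x y z, X = ofCoord a b c x y z := by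
  refine ⟨dg 0 X, dg 1 X, dg 2 X, X.1 1 2, X.1 2 0, X.1 0 1, ?_⟩
  apply JH.ext' <;> simp [dg, ofCoord]

theorem tr_ofCoord (a b c : ℂ) (x y z : HC) : tr (ofCoord a b c x y z) = a + b + c := by
  simp [tr, ofCoord, Matrix.trace, Fin.sum_univ_three]

theorem jmul_entry (X Y : JH) (i j : Fin 3) : (jmul X Y).1 i j = (1 / 2 : ℂ) •
    ((X.1 i 0 * Y.1 0 j + X.1 i 1 * Y.1 1 j + X.1 i 2 * Y.1 2 j)
      + (Y.1 i 0 * X.1 0 j + Y.1 i 1 * X.1 1 j + Y.1 i 2 * X.1 2 j)) := by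
  simp only [jmul, LinearMap.mk₂_apply, Matrix.smul_apply, Matrix.add_apply, Matrix.mul_apply,
    Fin.sum_univ_three]

theorem jmul_ofCoord (a b c : ℂ) (x y z : HC) (a' b' c' : ℂ) (x' y' z' : HC) :
    jmul (ofCoord a b c x y z) (ofCoord a' b' c' x' y' z') =
      ofCoord (a * a' + (y * star y').re + (z * star z').re)
        (b * b' + (x * star x').re + (z * star z').re)
        (c * c' + (x * star x').re + (y * star y').re)
        ((1 / 2 : ℂ) • (star (y * z' + y' * z) + (b + c) • x' + (b' + c') • x))
        ((1 / 2 : ℂ) • (star (z * x' + z' * x) + (c + a) • y' + (c' + a') • y))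
        ((1 / 2 : ℂ) • (star (x * y' + x' * y) + (a + b) • z' + (a' + b') • z)) := by
  apply JH.ext' <;> simp only [dg, jmul_entry] <;>
    simp only [ofCoord, Matrix.of_apply, Matrix.cons_val', Matrix.cons_val_zero, Matrix.cons_val_one,
      Matrix.cons_val_fin_one, Matrix.cons_val]
  · simp only [hm0, hm1, hm2, hm3, hs0, hs1, hs2, hs3,
    QuaternionAlgebra.re_add, QuaternionAlgebra.re_sub, QuaternionAlgebra.re_smul, QuaternionAlgebra.imI_add, QuaternionAlgebra.imI_sub, QuaternionAlgebra.imI_smul,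
    QuaternionAlgebra.imJ_add, QuaternionAlgebra.imJ_sub, QuaternionAlgebra.imJ_smul, QuaternionAlgebra.imK_add, QuaternionAlgebra.imK_sub, QuaternionAlgebra.imK_smul, smul_eq_mul,
    QuaternionAlgebra.re_coe, QuaternionAlgebra.imI_coe, QuaternionAlgebra.imJ_coe, QuaternionAlgebra.imK_coe]; ring
  · simp only [hm0, hm1, hm2, hm3, hs0, hs1, hs2, hs3,
    QuaternionAlgebra.re_add, QuaternionAlgebra.re_sub, QuaternionAlgebra.re_smul, QuaternionAlgebra.imI_add, QuaternionAlgebra.imI_sub, QuaternionAlgebra.imI_smul,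
    QuaternionAlgebra.imJ_add, QuaternionAlgebra.imJ_sub, QuaternionAlgebra.imJ_smul, QuaternionAlgebra.imK_add, QuaternionAlgebra.imK_sub, QuaternionAlgebra.imK_smul, smul_eq_mul,
    QuaternionAlgebra.re_coe, QuaternionAlgebra.imI_coe, QuaternionAlgebra.imJ_coe, QuaternionAlgebra.imK_coe]; ring
  · simp only [hm0, hm1, hm2, hm3, hs0, hs1, hs2, hs3,
    QuaternionAlgebra.re_add, QuaternionAlgebra.re_sub, QuaternionAlgebra.re_smul, QuaternionAlgebra.imI_add, QuaternionAlgebra.imI_sub, QuaternionAlgebra.imI_smul,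
    QuaternionAlgebra.imJ_add, QuaternionAlgebra.imJ_sub, QuaternionAlgebra.imJ_smul, QuaternionAlgebra.imK_add, QuaternionAlgebra.imK_sub, QuaternionAlgebra.imK_smul, smul_eq_mul,
    QuaternionAlgebra.re_coe, QuaternionAlgebra.imI_coe, QuaternionAlgebra.imJ_coe, QuaternionAlgebra.imK_coe]; ring
  all_goals ext <;> simp only [hm0, hm1, hm2, hm3, hs0, hs1, hs2, hs3,
    QuaternionAlgebra.re_add, QuaternionAlgebra.re_sub, QuaternionAlgebra.re_smul, QuaternionAlgebra.imI_add, QuaternionAlgebra.imI_sub, QuaternionAlgebra.imI_smul,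
    QuaternionAlgebra.imJ_add, QuaternionAlgebra.imJ_sub, QuaternionAlgebra.imJ_smul, QuaternionAlgebra.imK_add, QuaternionAlgebra.imK_sub, QuaternionAlgebra.imK_smul, smul_eq_mul,
    QuaternionAlgebra.re_coe, QuaternionAlgebra.imI_coe, QuaternionAlgebra.imJ_coe, QuaternionAlgebra.imK_coe] <;> ring

theorem smul_ofCoord (r a b c : ℂ) (x y z : HC) :
    r • ofCoord a b c x y z = ofCoord (r * a) (r * b) (r * c) (r • x) (r • y) (r • z) := by
  apply JH.ext' <;> simp [dg, ofCoord]

theorem add_ofCoord (a b c : ℂ) (x y z : HC) (a' b' c' : ℂ) (x' y' z' : HC) :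
    ofCoord a b c x y z + ofCoord a' b' c' x' y' z' =
      ofCoord (a + a') (b + b') (c + c') (x + x') (y + y') (z + z') := by
  apply JH.ext' <;> simp [dg, ofCoord]

theorem E_eq : E = ofCoord 1 1 1 0 0 0 := by
  apply JH.ext' <;> simp [dg, ofCoord, E]

theorem ip_ofCoord (a b c : ℂ) (x y z : HC) (a' b' c' : ℂ) (x' y' z' : HC) :
    ip (ofCoord a b c x y z) (ofCoord a' b' c' x' y' z') =
      a * a' + b * b' + c * c' + 2 * ((x * star x').re + (y * star y').re + (z * star z').re) := by
  simp only [ip, LinearMap.compr₂_apply, jmul_ofCoord, tr_ofCoord]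
  ring

theorem cross_ofCoord (a b c : ℂ) (x y z : HC) (a' b' c' : ℂ) (x' y' z' : HC) :
    cross (ofCoord a b c x y z) (ofCoord a' b' c' x' y' z') =
      ofCoord ((1 / 2 : ℂ) * (b * c' + c * b') - (x * star x').re)
        ((1 / 2 : ℂ) * (c * a' + a * c') - (y * star y').re)
        ((1 / 2 : ℂ) * (a * b' + b * a') - (z * star z').re)
        ((1 / 2 : ℂ) • (star (y * z' + y' * z) - a • x' - a' • x))
        ((1 / 2 : ℂ) • (star (z * x' + z' * x) - b • y' - b' • y))
        ((1 / 2 : ℂ) • (star (x * y' + x' * y) - c • z' - c' • z)) := by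
  have hs : ∀ X Y : JH, X - Y = X + (-1 : ℂ) • Y := fun X Y => by module
  simp only [cross, LinearMap.mk₂_apply, hs, E_eq, smul_ofCoord,
    jmul_ofCoord, tr_ofCoord, ip_ofCoord, add_ofCoord]
  congr 1
  · ring
  · ring
  · ring
  all_goals module

theorem ip_comm (X Y : JH) : ip X Y = ip Y X := by
  obtain ⟨a, b, c, x, y, z, rfl⟩ := exists_ofCoord X
  obtain ⟨a', b', c', x', y', z', rfl⟩ :=
    exists_ofCoord Y
  simp only [ip_ofCoord]
  simp only [hm0, hm1, hm2, hm3, hs0, hs1, hs2, hs3,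
    QuaternionAlgebra.re_add, QuaternionAlgebra.re_sub, QuaternionAlgebra.re_smul, QuaternionAlgebra.imI_add, QuaternionAlgebra.imI_sub, QuaternionAlgebra.imI_smul,
    QuaternionAlgebra.imJ_add, QuaternionAlgebra.imJ_sub, QuaternionAlgebra.imJ_smul, QuaternionAlgebra.imK_add, QuaternionAlgebra.imK_sub, QuaternionAlgebra.imK_smul, smul_eq_mul]
  ring

theorem jmul_comm (X Y : JH) : jmul X Y = jmul Y X :=
  Subtype.ext (by simp [jmul, add_comm])

theorem cross_comm (X Y : JH) : cross X Y = cross Y X := by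
  simp only [cross, LinearMap.mk₂_apply]
  rw [jmul_comm X Y, ip_comm X Y]
  module

theorem ip_eq_zero {X : JH} (h : ∀ Y, ip X Y = 0) : X = 0 := by
  obtain ⟨a, b, c, x, y, z, rfl⟩ := exists_ofCoord X
  have H := fun a' b' c' x' y' z' => h (ofCoord a' b' c' x' y' z')
  simp only [ip_ofCoord] at H
  have ha := H 1 0 0 0 0 0
  have hb := H 0 1 0 0 0 0
  have hc := H 0 0 1 0 0 0
  have hx0 := H 0 0 0 ⟨1, 0, 0, 0⟩ 0 0
  have hx1 := H 0 0 0 ⟨0, 1, 0, 0⟩ 0 0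
  have hx2 := H 0 0 0 ⟨0, 0, 1, 0⟩ 0 0
  have hx3 := H 0 0 0 ⟨0, 0, 0, 1⟩ 0 0
  have hy0 := H 0 0 0 0 ⟨1, 0, 0, 0⟩ 0
  have hy1 := H 0 0 0 0 ⟨0, 1, 0, 0⟩ 0
  have hy2 := H 0 0 0 0 ⟨0, 0, 1, 0⟩ 0
  have hy3 := H 0 0 0 0 ⟨0, 0, 0, 1⟩ 0
  have hz0 := H 0 0 0 0 0 ⟨1, 0, 0, 0⟩
  have hz1 := H 0 0 0 0 0 ⟨0, 1, 0, 0⟩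
  have hz2 := H 0 0 0 0 0 ⟨0, 0, 1, 0⟩
  have hz3 := H 0 0 0 0 0 ⟨0, 0, 0, 1⟩
  simp at ha hb hc hx0 hx1 hx2 hx3 hy0 hy1 hy2 hy3 hz0 hz1 hz2 hz3
  apply JH.ext'
  · simpa [dg, ofCoord] using ha
  · simpa [dg, ofCoord] using hb
  · simpa [dg, ofCoord] using hc
  all_goals ext <;> simp [ofCoord, *]

theorem ip_cross (X Y Z : JH) : ip X (cross Y Z) = ip (cross X Y) Z := by
  obtain ⟨a, b, c, x, y, z, rfl⟩ := exists_ofCoord X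
  obtain ⟨a', b', c', x', y', z', rfl⟩ :=
    exists_ofCoord Y
  obtain ⟨a'', b'', c'', x'', y'', z'', rfl⟩ := exists_ofCoord Z
  simp only [ip_ofCoord, cross_ofCoord]
  simp only [hm0, hm1, hm2, hm3, hs0, hs1, hs2, hs3,
    QuaternionAlgebra.re_add, QuaternionAlgebra.re_sub, QuaternionAlgebra.re_smul, QuaternionAlgebra.imI_add, QuaternionAlgebra.imI_sub, QuaternionAlgebra.imI_smul,
    QuaternionAlgebra.imJ_add, QuaternionAlgebra.imJ_sub, QuaternionAlgebra.imJ_smul, QuaternionAlgebra.imK_add, QuaternionAlgebra.imK_sub, QuaternionAlgebra.imK_smul, smul_eq_mul]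
  ring

/-- The multiplication operator `X̃ : Z ↦ X ∘ Z`. -/
noncomputable def L (X : JH) : Module.End ℂ JH := jmul X

/-- `X ∨ W = [X̃, W̃] + (X ∘ W - (1/3)(X, W)E)~`. -/
noncomputable def vee (X W : JH) : Module.End ℂ JH :=
  ⁅L X, L W⁆ + L (jmul X W - (1 / 3 * ip X W) • E)

theorem jmul_E (X : JH) : jmul E X = X := by
  apply Subtype.ext
  have : jmul E X = ⟨(1 / 2 : ℂ) • (E.1 * X.1 + X.1 * E.1), jmul_mem E X⟩ := rfl
  rw [this]
  change (1 / 2 : ℂ) • (1 * X.1 + X.1 * 1) = X.1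
  rw [one_mul, mul_one]; module

theorem jmul_E' (X : JH) : jmul X E = X := by rw [jmul_comm, jmul_E]

theorem tr_E : tr E = 3 := by rw [E_eq, tr_ofCoord]; norm_num

theorem ip_E (X : JH) : ip X E = tr X := by
  change tr (jmul X E) = tr X
  rw [jmul_E']

theorem jmul_adj (X : JH) : jmul X (cross X X) = (1 / 3 * ip X (cross X X)) • E := by
  obtain ⟨a, b, c, x, y, z, rfl⟩ := exists_ofCoord X
  simp only [cross_ofCoord, jmul_ofCoord, ip_ofCoord, smul_ofCoord, E_eq]
  congr 1
  any_goals ext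
  all_goals
    simp only [hm0, hm1, hm2, hm3, hs0, hs1, hs2, hs3,
      QuaternionAlgebra.re_add, QuaternionAlgebra.re_sub, QuaternionAlgebra.re_smul,
      QuaternionAlgebra.imI_add, QuaternionAlgebra.imI_sub, QuaternionAlgebra.imI_smul,
      QuaternionAlgebra.imJ_add, QuaternionAlgebra.imJ_sub, QuaternionAlgebra.imJ_smul,
      QuaternionAlgebra.imK_add, QuaternionAlgebra.imK_sub, QuaternionAlgebra.imK_smul,
      QuaternionAlgebra.re_zero, QuaternionAlgebra.imI_zero, QuaternionAlgebra.imJ_zero,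
      QuaternionAlgebra.imK_zero, smul_eq_mul]
    ring

theorem ip_cross_rot (X Y Z : JH) : ip X (cross Y Z) = ip Y (cross X Z) := by
  rw [ip_cross, ip_cross, cross_comm]

theorem jmul_cross_polar (X Y Z : JH) :
    jmul X (cross Y Z) + jmul Y (cross X Z) + jmul Z (cross X Y) = ip X (cross Y Z) • E := by
  have h1 := jmul_adj (X + Y + Z)
  have h2 := jmul_adj (X + Y)
  have h3 := jmul_adj (Y + Z)
  have h4 := jmul_adj (X + Z)
  have hX := jmul_adj X
  have hY := jmul_adj Y
  have hZ := jmul_adj Z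
  have e1 : ip Y (cross X Z) = ip X (cross Y Z) := ip_cross_rot Y X Z
  have e2 : ip Z (cross X Y) = ip X (cross Y Z) := by
    rw [ip_cross_rot, cross_comm]
  simp only [map_add, LinearMap.add_apply] at h1 h2 h3 h4
  rw [cross_comm Y X, cross_comm Z X, cross_comm Z Y, e1, e2] at h1
  rw [cross_comm Y X] at h2
  rw [cross_comm Z Y] at h3
  rw [cross_comm Z X] at h4
  linear_combination (norm := module) (1 / 2 : ℂ) • (h1 - h2 - h3 - h4 + hX + hY + hZ)

theorem cross_def (X Y : JH) : cross X Y = (1 / 2 : ℂ) • ((2 : ℂ) • jmul X Y - tr X • Y - tr Y • X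
      + (tr X * tr Y - ip X Y) • E) := rfl

theorem tr_cross (X Y : JH) : tr (cross X Y) = 1 / 2 * (tr X * tr Y - ip X Y) := by
  have h : tr (jmul X Y) = ip X Y := rfl
  rw [cross_def]
  simp only [map_smul, map_add, map_sub, h, tr_E, smul_eq_mul]
  ring

theorem jmul_val (X Y : JH) : (jmul X Y).1 = (1 / 2 : ℂ) • (X.1 * Y.1 + Y.1 * X.1) := rfl

theorem jmul_adj_self (X : JH) : jmul (cross X X) (cross X X) =
    (1 / 3 * ip X (cross X X)) • X - (tr X * (1 / 3 * ip X (cross X X))) • E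
      + tr (cross X X) • cross X X := by
  have hC : (cross X X).1 = X.1 * X.1 - tr X • X.1 + tr (cross X X) • 1 := by
    have h : cross X X = jmul X X - tr X • X + tr (cross X X) • E := by
      rw [tr_cross, cross_def]; module
    have h' := congrArg Subtype.val h
    have hj : (jmul X X).1 = X.1 * X.1 := by rw [jmul_val]; module
    rw [← hj]
    exact h'
  have hN : (1 / 2 : ℂ) • (X.1 * (cross X X).1 + (cross X X).1 * X.1) =
      (1 / 3 * ip X (cross X X)) • 1 := congrArg Subtype.val (jmul_adj X)
  apply Subtype.ext
  change _ = (1 / 3 * ip X (cross X X)) • X.1 - (tr X * (1 / 3 * ip X (cross X X))) • 1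
      + tr (cross X X) • (cross X X).1
  have hj : (jmul (cross X X) (cross X X)).1 = (cross X X).1 * (cross X X).1 := by
    rw [jmul_val]; module
  rw [hj]
  generalize 1 / 3 * ip X (cross X X) = n at hN ⊢
  generalize tr (cross X X) = s at hC ⊢
  generalize tr X = t at hC ⊢
  generalize (cross X X).1 = C at hC hN ⊢
  generalize X.1 = M at hC hN ⊢
  have hc : C * M = M * C := by
    rw [hC, add_mul, mul_add, sub_mul, mul_sub, mul_assoc, smul_mul_assoc, mul_smul_comm,
      smul_mul_assoc, mul_smul_comm, one_mul, mul_one]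
  have hN' : M * C = n • 1 := by
    rw [← hN, hc]; module
  calc C * C = (M * M - t • M + s • 1) * C := by rw [← hC]
    _ = M * (M * C) - t • (M * C) + s • C := by
      rw [add_mul, sub_mul, mul_assoc, smul_mul_assoc, smul_mul_assoc, one_mul]
    _ = _ := by
      rw [hN', mul_smul_comm, mul_one, smul_smul]

theorem adj_adj (X : JH) :
    cross (cross X X) (cross X X) = ((1 / 3 : ℂ) * ip X (cross X X)) • X := by
  have h := jmul_adj_self X
  have h1 : ip (cross X X) (cross X X) = tr (jmul (cross X X) (cross X X)) := rfl
  have h2 : ip X X = tr X * tr X - 2 * tr (cross X X) := by rw [tr_cross]; ring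
  rw [cross_def (cross X X), h1, h]
  simp only [map_add, map_sub, map_smul, tr_E, smul_eq_mul]
  module

theorem vee_apply (X W Z : JH) : vee X W Z =
    (1 / 2 * ip W Z) • X + (1 / 6 * ip X W) • Z - (2 : ℂ) • cross W (cross X Z) := by
  have h0 : vee X W Z = jmul X (jmul W Z) - jmul W (jmul X Z) + jmul (jmul X W) Z
      - (1 / 3 * ip X W) • Z := by
    simp only [vee, L, LinearMap.add_apply, Ring.lie_def, LinearMap.sub_apply, Module.End.mul_apply,
      map_sub, map_smul, LinearMap.smul_apply, jmul_E]
    module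
  have h := jmul_cross_polar X W Z
  rw [h0, cross_def W (cross X Z), tr_cross, ip_cross_rot W X Z, jmul_comm (jmul X W)]
  generalize ip X (cross W Z) = n at h ⊢
  rw [cross_def W Z, cross_def X Z, cross_def X W] at h
  rw [cross_def X Z]
  simp only [map_smul, map_add, map_sub, jmul_E', jmul_comm W X, jmul_comm Z X, jmul_comm Z W] at h ⊢
  linear_combination (norm := module) h

end QuatE8

attribute [local instance 100] LieRing.ofAssociativeRing

namespace QuatE8

theorem ip_nondegenerate : LinearMap.BilinForm.Nondegenerate ip := by
  constructor
  · intro X h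
    exact ip_eq_zero h
  · intro X h
    exact ip_eq_zero fun Y => (ip_comm X Y).trans (h Y)

theorem ip_ext {X Y : JH} (h : ∀ Z, ip X Z = ip Y Z) : X = Y :=
  sub_eq_zero.1 (ip_eq_zero fun Z => by rw [map_sub, LinearMap.sub_apply, h, sub_self])

/-- The transpose `ᵗφ` with respect to the inner product: `(ᵗφ X, Y) = (X, φ Y)`. -/
noncomputable def transp (φ : Module.End ℂ JH) : Module.End ℂ JH :=
  LinearMap.BilinForm.leftAdjointOfNondegenerate ip ip_nondegenerate φ

theorem ip_transp (φ : Module.End ℂ JH) (X Y : JH) : ip (transp φ X) Y = ip X (φ Y) :=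
  LinearMap.BilinForm.isAdjointPairLeftAdjointOfNondegenerate ip ip_nondegenerate φ X Y

theorem transp_add (φ ψ : Module.End ℂ JH) : transp (φ + ψ) = transp φ + transp ψ := by
  ext1 X; exact ip_ext fun Z => by simp [ip_transp]

theorem transp_smul (c : ℂ) (φ : Module.End ℂ JH) : transp (c • φ) = c • transp φ := by
  ext1 X; exact ip_ext fun Z => by simp [ip_transp]

theorem e6_polar {φ : Module.End ℂ JH} (h : ∀ X, ip (φ X) (cross X X) = 0) (X Y Z : JH) :
    ip (φ X) (cross Y Z) + ip (φ Y) (cross X Z) + ip (φ Z) (cross X Y) = 0 := by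
  have h1 := h (X + Y + Z)
  have h2 := h (X + Y)
  have h3 := h (Y + Z)
  have h4 := h (X + Z)
  have hX := h X
  have hY := h Y
  have hZ := h Z
  simp only [map_add, LinearMap.add_apply] at h1 h2 h3 h4
  rw [cross_comm Y X, cross_comm Z X, cross_comm Z Y] at h1
  rw [cross_comm Y X] at h2
  rw [cross_comm Z Y] at h3
  rw [cross_comm Z X] at h4
  linear_combination (1 / 2 : ℂ) * (h1 - h2 - h3 - h4 + hX + hY + hZ)

/-- `(e_{6,H})^C = {φ | (φX, X, X) = 0}`, where `(X, Y, Z) = (X, Y × Z)`. -/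
noncomputable def e6 : LieSubalgebra ℂ (Module.End ℂ JH) where
  carrier := {φ | ∀ X, ip (φ X) (cross X X) = 0}
  add_mem' {φ ψ} hφ hψ X := by
    rw [LinearMap.add_apply, map_add, LinearMap.add_apply, hφ X, hψ X, add_zero]
  zero_mem' X := by simp
  smul_mem' c φ hφ X := by
    rw [LinearMap.smul_apply, map_smul, LinearMap.smul_apply, hφ X, smul_zero]
  lie_mem' {φ ψ} hφ hψ X := by
    have h1 := e6_polar hφ (ψ X) X X
    have h2 := e6_polar hψ (φ X) X X
    have h3 : ip (φ X) (cross (ψ X) X) = ip (ψ X) (cross (φ X) X) := by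
      rw [ip_cross, cross_comm, ← ip_cross]
    simp only [Ring.lie_def, LinearMap.sub_apply, Module.End.mul_apply, map_sub]
    linear_combination h1 - h2 - 2 * h3

theorem transp_cross {φ : Module.End ℂ JH} (h : φ ∈ e6) (X Y : JH) :
    transp φ (cross X Y) = -(cross (φ X) Y + cross X (φ Y)) := by
  refine ip_ext fun Z => ?_
  have h1 := e6_polar h X Y Z
  rw [ip_transp, ip_comm _ (φ Z)]
  simp only [map_neg, map_add, LinearMap.neg_apply, LinearMap.add_apply]
  rw [← ip_cross (φ X) Y Z, cross_comm X (φ Y), ← ip_cross (φ Y) X Z]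
  linear_combination h1

theorem adj_lin (A Y : JH) : cross (cross Y A) (cross A A) =
    (1 / 4 : ℂ) • (ip Y (cross A A) • A + (1 / 3 * ip A (cross A A)) • Y) := by
  have h := fun t : ℂ => adj_adj (A + t • Y)
  have h0 := h 1
  have h1 := h (-1)
  have h2 := h 2
  have h3 := h (-2)
  have c1 := cross_comm A Y
  have c2 : ip A (cross Y A) = ip Y (cross A A) := by
    rw [cross_comm Y A, ip_cross, ip_comm]
  have c3 : ip A (cross Y Y) = ip Y (cross Y A) := by
    rw [ip_comm, ip_cross]
  simp only [map_add, map_smul, LinearMap.add_apply, LinearMap.smul_apply, smul_eq_mul,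
    c1, c2, c3, cross_comm (cross A A) (cross Y A), cross_comm (cross Y Y) (cross Y A),
    cross_comm (cross A A) (cross Y Y)] at h0 h1 h2 h3
  linear_combination (norm := module) (1 / 6 : ℂ) • (h0 - h1) - (1 / 48 : ℂ) • (h2 - h3)

theorem cross_E (X : JH) : cross X E = (1 / 2 : ℂ) • (tr X • E - X) := by
  simp only [cross, LinearMap.mk₂_apply]
  rw [jmul_E', ip_E, tr_E]
  module

theorem cross_E_E : cross E E = E := by
  rw [cross_E, tr_E]; module

theorem sym_eq_zero (K : JH →ₗ[ℂ] JH →ₗ[ℂ] JH) (hs : ∀ X Y, K X Y = K Y X)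
    (h4 : ∀ A, K (cross A A) (cross A A) = 0) (X Y : JH) : K X Y = 0 := by
  have hE : K E E = 0 := by simpa [cross_E_E] using h4 E
  have key : ∀ Y, K (cross Y E) E = 0 ∧
      K (cross Y Y) E + (2 : ℂ) • K (cross Y E) (cross Y E) = 0 := fun Y => by
    have h' := fun t : ℂ => h4 (E + t • Y)
    have h0 := h' 1
    have h1 := h' (-1)
    have h2 := h' 2
    have h3 := h' (-2)
    simp only [map_add, map_smul, LinearMap.add_apply, LinearMap.smul_apply, cross_E_E,
      cross_comm E Y, hs E (cross Y E), hs E (cross Y Y), hs (cross Y Y) (cross Y E), hE]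
      at h0 h1 h2 h3
    constructor
    · linear_combination (norm := module) (1 / 6 : ℂ) • (h0 - h1) - (1 / 48 : ℂ) • (h2 - h3)
    · linear_combination (norm := module) (1 / 3 : ℂ) • (h0 + h1) - (1 / 48 : ℂ) • (h2 + h3)
  have k1 : ∀ Y, K Y E = 0 := fun Y => by
    have := (key Y).1
    simp only [cross_E, map_smul, map_sub, LinearMap.smul_apply, LinearMap.sub_apply, hE] at this
    linear_combination (norm := module) (-2 : ℂ) • this
  have k2 : ∀ Y, K Y Y = 0 := fun Y => by
    have := (key Y).2
    rw [k1] at this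
    simp only [cross_E, map_smul, map_sub, LinearMap.smul_apply, LinearMap.sub_apply, hE, k1,
      hs E Y] at this
    linear_combination (norm := module) (2 : ℂ) • this
  have := k2 (X + Y)
  simp only [map_add, LinearMap.add_apply, k2, hs Y X] at this
  linear_combination (norm := module) (1 / 2 : ℂ) • this

theorem e6_cross {φ : Module.End ℂ JH} (h : φ ∈ e6) (X Y : JH) :
    φ (cross X Y) = -(cross (transp φ X) Y + cross X (transp φ Y)) := by
  let K : JH →ₗ[ℂ] JH →ₗ[ℂ] JH := cross.compr₂ φ + cross.compl₁₂ (transp φ) LinearMap.id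
    + cross.compl₁₂ LinearMap.id (transp φ)
  have hK : ∀ X Y, K X Y = φ (cross X Y) + cross (transp φ X) Y + cross X (transp φ Y) :=
    fun X Y => rfl
  have hs : ∀ X Y, K X Y = K Y X := fun X Y => by
    rw [hK, hK, cross_comm X Y, cross_comm (transp φ X) Y, cross_comm X (transp φ Y)]; abel
  have h4 : ∀ A, K (cross A A) (cross A A) = 0 := fun A => by
    rw [hK, transp_cross h, adj_adj, map_smul, cross_comm A (φ A)]
    have h1 := adj_lin A (φ A)
    have h2 : ip (φ A) (cross A A) = 0 := h A
    rw [h2] at h1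
    rw [cross_comm (cross A A)]
    simp only [map_neg, map_add, LinearMap.neg_apply, LinearMap.add_apply]
    rw [h1]
    module
  have k3 : K X Y = 0 := sym_eq_zero K hs h4 X Y
  rw [hK] at k3
  linear_combination (norm := module) k3

theorem transp_mem {φ : Module.End ℂ JH} (h : φ ∈ e6) : transp φ ∈ e6 := by
  intro X
  have h1 := ip_transp φ X (cross X X)
  rw [e6_cross h, map_neg, map_add, cross_comm (transp φ X), ip_cross X X (transp φ X), ip_comm _ (transp φ X)] at h1
  linear_combination (1 / 3 : ℂ) * h1

theorem vee_mem (X W : JH) : vee X W ∈ e6 := by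
  intro Z
  have h := adj_lin Z X
  have h1 : ip (cross W (cross X Z)) (cross Z Z) = ip W (cross (cross X Z) (cross Z Z)) :=
    (ip_cross _ _ _).symm
  rw [vee_apply]
  simp only [map_sub, map_add, map_smul, LinearMap.sub_apply, LinearMap.add_apply,
    LinearMap.smul_apply, smul_eq_mul]
  rw [h1, h, ip_comm X W]
  simp only [map_add, map_smul, smul_eq_mul]
  ring

theorem transp_vee (X W : JH) : transp (vee X W) = vee W X := by
  ext1 Z
  refine ip_ext fun U => ?_
  rw [ip_transp, vee_apply, vee_apply]
  simp only [map_sub, map_add, map_smul, LinearMap.sub_apply, LinearMap.add_apply,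
    LinearMap.smul_apply, smul_eq_mul]
  have : ip Z (cross W (cross X U)) = ip (cross X (cross W Z)) U := by
    rw [ip_cross, ip_cross, cross_comm Z W, cross_comm X]
  rw [this, ip_comm X W, ip_comm Z X]
  ring

theorem lie_vee {φ : Module.End ℂ JH} (h : φ ∈ e6) (X W : JH) :
    ⁅φ, vee X W⁆ = vee (φ X) W - vee X (transp φ W) := by
  ext1 Z
  have h0 : ⁅φ, vee X W⁆ Z = φ (vee X W Z) - vee X W (φ Z) := rfl
  have h1 : ip (φ X) W = ip X (transp φ W) := by rw [ip_comm, ← ip_transp, ip_comm]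
  have h2 : ip W (φ Z) = ip (transp φ W) Z := by rw [ip_transp]
  rw [h0]
  simp only [LinearMap.sub_apply, vee_apply, map_sub, map_add, map_smul, e6_cross h,
    transp_cross h, map_neg, LinearMap.neg_apply, LinearMap.add_apply, h1, h2]
  module

/-- The Lie algebra `(f_{4,H})^C` of derivations of the Jordan algebra `J(3, H^C)`. -/
noncomputable def f4 : LieSubalgebra ℂ (Module.End ℂ JH) where
  carrier := {δ | ∀ X Y, δ (jmul X Y) = jmul (δ X) Y + jmul X (δ Y)}
  add_mem' {δ ε} hδ hε X Y := by
    simp only [LinearMap.add_apply, hδ X Y, hε X Y, map_add]; abel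
  zero_mem' X Y := by simp
  smul_mem' c δ hδ X Y := by
    simp only [LinearMap.smul_apply, hδ X Y, map_smul, smul_add]
  lie_mem' {δ ε} hδ hε X Y := by
    simp only [Set.mem_ofPred_eq] at hδ hε
    simp only [Ring.lie_def, LinearMap.sub_apply, Module.End.mul_apply, hδ, hε, map_sub, map_add]
    abel

/-- The invariant form `(δ₁, δ₂)_4` on `(f_{4,H})^C`. It is the unique bilinear form with
`(δ, [Ã, B̃])_4 = (δA, B)`, see `form4_lie_L` and `form4_unique`; that is, `(1/2) tr(δ₁ δ₂)`. -/
noncomputable def form4 (δ₁ δ₂ : f4) : ℂ :=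
  1 / 2 * LinearMap.trace ℂ JH (δ₁.1 * δ₂.1)

theorem lie_L_val (A B Z : JH) : (⁅L A, L B⁆ Z).1 =
    (1 / 4 : ℂ) • ((A.1 * B.1 - B.1 * A.1) * Z.1 - Z.1 * (A.1 * B.1 - B.1 * A.1)) := by
  have h : ⁅L A, L B⁆ Z = jmul A (jmul B Z) - jmul B (jmul A Z) := rfl
  rw [h, Submodule.coe_sub]
  simp only [jmul_val, mul_smul_comm, smul_mul_assoc, mul_add, add_mul, mul_sub, sub_mul, mul_assoc]
  module

theorem lie_L_mem (A B : JH) : ⁅L A, L B⁆ ∈ f4 := by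
  intro X Y
  apply Subtype.ext
  rw [Submodule.coe_add]
  simp only [lie_L_val, jmul_val, mul_smul_comm, smul_mul_assoc, mul_add, add_mul, mul_sub, sub_mul,
    mul_assoc]
  module

def qmk (a b c d : ℂ) : HC := ⟨a, b, c, d⟩

/-- A basis of `H^C`. -/
def hb : Fin 4 → HC := ![qmk 1 0 0 0, qmk 0 1 0 0, qmk 0 0 1 0, qmk 0 0 0 1]

theorem trace_eq (f : Module.End ℂ JH) : LinearMap.trace ℂ JH f =
    ip (ofCoord 1 0 0 0 0 0) (f (ofCoord 1 0 0 0 0 0))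
    + ip (ofCoord 0 1 0 0 0 0) (f (ofCoord 0 1 0 0 0 0))
    + ip (ofCoord 0 0 1 0 0 0) (f (ofCoord 0 0 1 0 0 0))
    + 1 / 2 * ∑ i, (ip (ofCoord 0 0 0 (hb i) 0 0) (f (ofCoord 0 0 0 (hb i) 0 0))
      + ip (ofCoord 0 0 0 0 (hb i) 0) (f (ofCoord 0 0 0 0 (hb i) 0))
      + ip (ofCoord 0 0 0 0 0 (hb i)) (f (ofCoord 0 0 0 0 0 (hb i)))) := by
  have h : f = (ip (ofCoord 1 0 0 0 0 0)).smulRight (f (ofCoord 1 0 0 0 0 0))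
    + (ip (ofCoord 0 1 0 0 0 0)).smulRight (f (ofCoord 0 1 0 0 0 0))
    + (ip (ofCoord 0 0 1 0 0 0)).smulRight (f (ofCoord 0 0 1 0 0 0))
    + (1 / 2 : ℂ) • ∑ i, ((ip (ofCoord 0 0 0 (hb i) 0 0)).smulRight (f (ofCoord 0 0 0 (hb i) 0 0))
      + (ip (ofCoord 0 0 0 0 (hb i) 0)).smulRight (f (ofCoord 0 0 0 0 (hb i) 0))
      + (ip (ofCoord 0 0 0 0 0 (hb i))).smulRight (f (ofCoord 0 0 0 0 0 (hb i)))) := by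
    ext1 Z
    simp only [LinearMap.add_apply, LinearMap.smul_apply, LinearMap.sum_apply,
      LinearMap.smulRight_apply, ← map_smul, ← map_add, ← map_sum]
    congr 1
    obtain ⟨a, b, c, x, y, z, rfl⟩ := exists_ofCoord Z
    simp only [Fin.sum_univ_four, ip_ofCoord, smul_ofCoord, add_ofCoord, hb, Matrix.cons_val]
    congr 1
    · simp
    · simp
    · simp
    all_goals ext <;> simp [qmk]
  conv_lhs => rw [h]
  simp only [map_add, map_smul, map_sum, LinearMap.trace_smulRight, smul_eq_mul]

theorem jmul_assoc_ip (X Y Z : JH) : ip (jmul X Y) Z = ip Y (jmul X Z) := by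
  obtain ⟨a, b, c, x, y, z, rfl⟩ := exists_ofCoord X
  obtain ⟨a', b', c', x', y', z', rfl⟩ := exists_ofCoord Y
  obtain ⟨a'', b'', c'', x'', y'', z'', rfl⟩ := exists_ofCoord Z
  simp only [ip_ofCoord, jmul_ofCoord]
  simp only [hm0, hm1, hm2, hm3, hs0, hs1, hs2, hs3,
    QuaternionAlgebra.re_add, QuaternionAlgebra.re_sub, QuaternionAlgebra.re_smul, QuaternionAlgebra.imI_add, QuaternionAlgebra.imI_sub, QuaternionAlgebra.imI_smul,
    QuaternionAlgebra.imJ_add, QuaternionAlgebra.imJ_sub, QuaternionAlgebra.imJ_smul, QuaternionAlgebra.imK_add, QuaternionAlgebra.imK_sub, QuaternionAlgebra.imK_smul, smul_eq_mul]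
  ring

theorem ipE1 (a b c : ℂ) (x y z : HC) (a' b' c' : ℂ) (x' y' z' : HC) :
    ip (jmul (ofCoord a b c x y z) (ofCoord 1 0 0 0 0 0)) (jmul (ofCoord a' b' c' x' y' z') (ofCoord 1 0 0 0 0 0)) =
      a * a' + 1 / 2 * ((y * star y').re + (z * star z').re) := by
  simp only [ip_ofCoord, jmul_ofCoord]
  simp only [hm0, hm1, hm2, hm3, hs0, hs1, hs2, hs3,
    QuaternionAlgebra.re_add, QuaternionAlgebra.re_smul, QuaternionAlgebra.imI_add, QuaternionAlgebra.imI_smul,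
    QuaternionAlgebra.imJ_add, QuaternionAlgebra.imJ_smul, QuaternionAlgebra.imK_add,
    QuaternionAlgebra.imK_smul, smul_eq_mul, QuaternionAlgebra.re_zero, QuaternionAlgebra.imI_zero,
    QuaternionAlgebra.imJ_zero, QuaternionAlgebra.imK_zero]
  ring

theorem ipE2 (a b c : ℂ) (x y z : HC) (a' b' c' : ℂ) (x' y' z' : HC) :
    ip (jmul (ofCoord a b c x y z) (ofCoord 0 1 0 0 0 0)) (jmul (ofCoord a' b' c' x' y' z') (ofCoord 0 1 0 0 0 0)) =
      b * b' + 1 / 2 * ((x * star x').re + (z * star z').re) := by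
  simp only [ip_ofCoord, jmul_ofCoord]
  simp only [hm0, hm1, hm2, hm3, hs0, hs1, hs2, hs3,
    QuaternionAlgebra.re_add, QuaternionAlgebra.re_smul, QuaternionAlgebra.imI_add, QuaternionAlgebra.imI_smul,
    QuaternionAlgebra.imJ_add, QuaternionAlgebra.imJ_smul, QuaternionAlgebra.imK_add,
    QuaternionAlgebra.imK_smul, smul_eq_mul, QuaternionAlgebra.re_zero, QuaternionAlgebra.imI_zero,
    QuaternionAlgebra.imJ_zero, QuaternionAlgebra.imK_zero]
  ring

theorem ipE3 (a b c : ℂ) (x y z : HC) (a' b' c' : ℂ) (x' y' z' : HC) :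
    ip (jmul (ofCoord a b c x y z) (ofCoord 0 0 1 0 0 0)) (jmul (ofCoord a' b' c' x' y' z') (ofCoord 0 0 1 0 0 0)) =
      c * c' + 1 / 2 * ((x * star x').re + (y * star y').re) := by
  simp only [ip_ofCoord, jmul_ofCoord]
  simp only [hm0, hm1, hm2, hm3, hs0, hs1, hs2, hs3,
    QuaternionAlgebra.re_add, QuaternionAlgebra.re_smul, QuaternionAlgebra.imI_add, QuaternionAlgebra.imI_smul,
    QuaternionAlgebra.imJ_add, QuaternionAlgebra.imJ_smul, QuaternionAlgebra.imK_add,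
    QuaternionAlgebra.imK_smul, smul_eq_mul, QuaternionAlgebra.re_zero, QuaternionAlgebra.imI_zero,
    QuaternionAlgebra.imJ_zero, QuaternionAlgebra.imK_zero]
  ring

theorem ipF1 (a b c : ℂ) (x y z : HC) (a' b' c' : ℂ) (x' y' z' : HC) (u : HC) :
    ip (jmul (ofCoord a b c x y z) (ofCoord 0 0 0 u 0 0)) (jmul (ofCoord a' b' c' x' y' z') (ofCoord 0 0 0 u 0 0)) =
      2 * ((x * star u).re * (x' * star u).re) +
      1 / 2 * ((b + c) * (b' + c') + (y * star y').re + (z * star z').re) * (u * star u).re := by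
  simp only [ip_ofCoord, jmul_ofCoord]
  simp only [hm0, hm1, hm2, hm3, hs0, hs1, hs2, hs3,
    QuaternionAlgebra.re_add, QuaternionAlgebra.re_smul, QuaternionAlgebra.imI_add, QuaternionAlgebra.imI_smul,
    QuaternionAlgebra.imJ_add, QuaternionAlgebra.imJ_smul, QuaternionAlgebra.imK_add,
    QuaternionAlgebra.imK_smul, smul_eq_mul, QuaternionAlgebra.re_zero, QuaternionAlgebra.imI_zero,
    QuaternionAlgebra.imJ_zero, QuaternionAlgebra.imK_zero]
  ring

theorem ipF2 (a b c : ℂ) (x y z : HC) (a' b' c' : ℂ) (x' y' z' : HC) (u : HC) :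
    ip (jmul (ofCoord a b c x y z) (ofCoord 0 0 0 0 u 0)) (jmul (ofCoord a' b' c' x' y' z') (ofCoord 0 0 0 0 u 0)) =
      2 * ((y * star u).re * (y' * star u).re) +
      1 / 2 * ((a + c) * (a' + c') + (x * star x').re + (z * star z').re) * (u * star u).re := by
  simp only [ip_ofCoord, jmul_ofCoord]
  simp only [hm0, hm1, hm2, hm3, hs0, hs1, hs2, hs3,
    QuaternionAlgebra.re_add, QuaternionAlgebra.re_smul, QuaternionAlgebra.imI_add, QuaternionAlgebra.imI_smul,
    QuaternionAlgebra.imJ_add, QuaternionAlgebra.imJ_smul, QuaternionAlgebra.imK_add,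
    QuaternionAlgebra.imK_smul, smul_eq_mul, QuaternionAlgebra.re_zero, QuaternionAlgebra.imI_zero,
    QuaternionAlgebra.imJ_zero, QuaternionAlgebra.imK_zero]
  ring

theorem ipF3 (a b c : ℂ) (x y z : HC) (a' b' c' : ℂ) (x' y' z' : HC) (u : HC) :
    ip (jmul (ofCoord a b c x y z) (ofCoord 0 0 0 0 0 u)) (jmul (ofCoord a' b' c' x' y' z') (ofCoord 0 0 0 0 0 u)) =
      2 * ((z * star u).re * (z' * star u).re) +
      1 / 2 * ((a + b) * (a' + b') + (x * star x').re + (y * star y').re) * (u * star u).re := by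
  simp only [ip_ofCoord, jmul_ofCoord]
  simp only [hm0, hm1, hm2, hm3, hs0, hs1, hs2, hs3,
    QuaternionAlgebra.re_add, QuaternionAlgebra.re_smul, QuaternionAlgebra.imI_add, QuaternionAlgebra.imI_smul,
    QuaternionAlgebra.imJ_add, QuaternionAlgebra.imJ_smul, QuaternionAlgebra.imK_add,
    QuaternionAlgebra.imK_smul, smul_eq_mul, QuaternionAlgebra.re_zero, QuaternionAlgebra.imI_zero,
    QuaternionAlgebra.imJ_zero, QuaternionAlgebra.imK_zero]
  ring

theorem ip_L_L (X Y e : JH) : ip e ((L X * L Y) e) = ip (jmul X e) (jmul Y e) :=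
  (jmul_assoc_ip X e (jmul Y e)).symm

theorem trace_L_L_coord (a b c : ℂ) (x y z : HC) (a' b' c' : ℂ) (x' y' z' : HC) :
    LinearMap.trace ℂ JH (L (ofCoord a b c x y z) * L (ofCoord a' b' c' x' y' z')) =
      2 * ip (ofCoord a b c x y z) (ofCoord a' b' c' x' y' z') + (a + b + c) * (a' + b' + c') := by
  rw [trace_eq]
  simp only [ip_L_L, ipE1, ipE2, ipE3, ipF1, ipF2, ipF3]
  rw [ip_ofCoord]
  simp only [Fin.sum_univ_four, hb, Matrix.cons_val, hm0, hs0, hs1, hs2, hs3, qmk]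
  ring

theorem trace_L_L (X Y : JH) :
    LinearMap.trace ℂ JH (L X * L Y) = 2 * ip X Y + tr X * tr Y := by
  obtain ⟨a, b, c, x, y, z, rfl⟩ := exists_ofCoord X
  obtain ⟨a', b', c', x', y', z', rfl⟩ := exists_ofCoord Y
  rw [trace_L_L_coord, tr_ofCoord, tr_ofCoord]

theorem tr_derivation {δ : Module.End ℂ JH} (h : δ ∈ f4) (A : JH) : tr (δ A) = 0 := by
  have h1 : L (δ A) = δ * L A - L A * δ := by
    ext1 Z
    have := h A Z
    simp only [L, LinearMap.sub_apply, Module.End.mul_apply, this]; abel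
  have h2 := trace_L_L (δ A) E
  have h3 : L E = 1 := by ext1 Z; exact jmul_E Z
  rw [h3, mul_one, h1, map_sub (LinearMap.trace ℂ JH) (δ * L A) (L A * δ), LinearMap.trace_mul_comm,
    sub_self, ip_E, tr_E] at h2
  linear_combination (-1 / 5 : ℂ) * h2

/-- The form `( , )_4` is normalised by `(δ, [Ã, B̃])_4 = (δA, B)`. -/
theorem form4_lie_L (δ : f4) (A B : JH) : form4 δ ⟨⁅L A, L B⁆, lie_L_mem A B⟩ = ip (δ.1 A) B := by
  have h1 : L (δ.1 A) = δ.1 * L A - L A * δ.1 := by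
    ext1 Z
    have := δ.2 A Z
    simp only [L, LinearMap.sub_apply, Module.End.mul_apply, this]; abel
  have h2 := trace_L_L (δ.1 A) B
  rw [h1, tr_derivation δ.2, sub_mul (δ.1 * L A), map_sub (LinearMap.trace ℂ JH) (δ.1 * L A * L B)] at h2
  have h3 : δ.1 * ⁅L A, L B⁆ = δ.1 * L A * L B - δ.1 * L B * L A := by
    have h : ⁅L A, L B⁆ = L A * L B - L B * L A := rfl
    rw [h, mul_sub δ.1, mul_assoc, mul_assoc]
  have h4 := LinearMap.trace_mul_cycle ℂ δ.1 (L B) (L A)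
  rw [form4, h3, map_sub (LinearMap.trace ℂ JH) (δ.1 * L A * L B), h4]
  linear_combination (1 / 2 : ℂ) * h2

theorem delta_mem {φ : Module.End ℂ JH} (h : φ ∈ e6) : φ - L (φ E) ∈ f4 := by
  have ht : tr (φ E) = 0 := by
    have := h E
    rwa [cross_E_E, ip_E] at this
  have hL : L (φ E) = vee (φ E) E := by
    have h3 : L E = 1 := by ext1 Z; exact jmul_E Z
    rw [vee, h3, jmul_E', ip_E, ht, Ring.lie_def, mul_one, one_mul, sub_self]
    simp
  have hδ : φ - L (φ E) ∈ e6 := sub_mem h (hL ▸ vee_mem _ _)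
  have hδE : (φ - L (φ E)) E = 0 := by
    change φ E - jmul (φ E) E = 0
    rw [jmul_E', sub_self]
  generalize φ - L (φ E) = δ at hδ hδE
  have h1 : transp δ E = 0 := by
    have := transp_cross hδ E E
    simpa [cross_E_E, hδE] using this
  have h2 : ∀ X, transp δ X = - δ X := fun X => by
    have := e6_cross hδ X E
    have h3 : tr (transp δ X) = 0 := by rw [← ip_E, ip_transp, hδE, map_zero]
    rw [cross_E, cross_E, h1, h3] at this
    simp only [map_smul, map_sub, hδE, smul_zero, zero_smul, zero_sub, map_zero, add_zero] at this
    linear_combination (norm := module) (-2 : ℂ) • this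
  have h3 : ∀ X Y, ip (δ X) Y + ip X (δ Y) = 0 := fun X Y => by
    have := ip_transp δ X Y
    rw [h2, map_neg, LinearMap.neg_apply] at this
    linear_combination -this
  have h4 : ∀ X, tr (δ X) = 0 := fun X => by
    have := h3 X E
    rwa [hδE, map_zero, add_zero, ip_E] at this
  have h5 : ∀ X Y, δ (cross X Y) = cross (δ X) Y + cross X (δ Y) := fun X Y => by
    rw [e6_cross hδ, h2, h2, map_neg, map_neg, LinearMap.neg_apply]; abel
  have h6 : ∀ X Y, jmul X Y = cross X Y + (1 / 2 : ℂ) • (tr X • Y + tr Y • X -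
      (tr X * tr Y - ip X Y) • E) := fun X Y => by
    simp only [cross, LinearMap.mk₂_apply]
    module
  intro X Y
  rw [h6, h6, h6]
  simp only [map_add, map_sub, map_smul, h5, h4, hδE]
  have := h3 X Y
  rw [add_eq_zero_iff_eq_neg.1 this]
  module

/-- The form `(φ₁, φ₂)_6 = (δ₁, δ₂)_4 + (T₁, T₂)` on `(e_{6,H})^C`, where `φᵢ = δᵢ + T̃ᵢ` with `δᵢ` in
`(f_{4,H})^C` and `tr Tᵢ = 0`. As derivations annihilate `E`, this forces `Tᵢ = φᵢ E`. -/
noncomputable def form6 (φ₁ φ₂ : e6) : ℂ :=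
  form4 ⟨φ₁.1 - L (φ₁.1 E), delta_mem φ₁.2⟩ ⟨φ₂.1 - L (φ₂.1 E), delta_mem φ₂.2⟩
    + ip (φ₁.1 E) (φ₂.1 E)

/-- The form `( , )_4` is determined by `(δ, [Ã, B̃])_4 = (δA, B)`. -/
theorem form4_unique (β : f4 → f4 →ₗ[ℂ] ℂ)
    (h : ∀ (δ : f4) (A B : JH), β δ ⟨⁅L A, L B⁆, lie_L_mem A B⟩ = ip (δ.1 A) B) (δ ε : f4) :
    β δ ε = form4 δ ε := by
  let F : f4 →ₗ[ℂ] f4 →ₗ[ℂ] ℂ := LinearMap.mk₂ ℂ form4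
    (fun a b c => by simp [form4, add_mul, mul_add])
    (fun a b c => by simp [form4]; ring)
    (fun a b c => by simp [form4, mul_add])
    (fun a b c => by simp [form4]; ring)
  have hF : ∀ δ ε, F δ ε = form4 δ ε := fun _ _ => rfl
  have hinj : Function.Injective F := by
    rw [← LinearMap.ker_eq_bot, LinearMap.ker_eq_bot']
    intro m hm
    apply Subtype.ext
    ext1 A
    refine ip_eq_zero fun B => ?_
    rw [← form4_lie_L m A B, ← hF, hm, LinearMap.zero_apply]
  have hsurj : Function.Surjective F :=
    (LinearMap.injective_iff_surjective_of_finrank_eq_finrank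
      (Subspace.dual_finrank_eq (K := ℂ) (V := f4)).symm).1 hinj
  let S : Submodule ℂ f4 := Submodule.span ℂ
    {x | ∃ A B, x = ⟨⁅L A, L B⁆, lie_L_mem A B⟩}
  have hS : S = ⊤ := by
    by_contra hne
    obtain ⟨g, hg0, hg⟩ := Submodule.exists_le_ker_of_lt_top S (lt_top_iff_ne_top.2 hne)
    obtain ⟨m, rfl⟩ := hsurj g
    apply hg0
    have hm : m = 0 := by
      apply Subtype.ext
      ext1 A
      refine ip_eq_zero fun B => ?_
      rw [← form4_lie_L m A B, ← hF]
      exact hg (Submodule.subset_span ⟨A, B, rfl⟩)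
    rw [hm, map_zero]
  have hle : S ≤ LinearMap.ker (β δ - F δ) := Submodule.span_le.2 (by
    rintro _ ⟨A, B, rfl⟩
    change (β δ - F δ) _ = 0
    rw [LinearMap.sub_apply, h, hF, form4_lie_L, sub_self])
  have hε : ε ∈ S := hS ▸ Submodule.mem_top
  exact sub_eq_zero.1 (hle hε)

/-- The Freudenthal space `(P_H)^C`; an element is `(X, Y, ξ, η)`. -/
abbrev PH : Type := JH × JH × ℂ × ℂ

/-- The skew form `{P, Q} = (X, W) - (Y, Z) + ξω - ηζ` for `P = (X, Y, ξ, η)`, `Q = (Z, W, ζ, ω)`. -/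
noncomputable def skew (P Q : PH) : ℂ :=
  ip P.1 Q.2.1 - ip P.2.1 Q.1 + P.2.2.1 * Q.2.2.2 - P.2.2.2 * Q.2.2.1

/-- The linear map `Φ(φ, A, B, ν)` of `(P_H)^C`. -/
noncomputable def Phi (φ : Module.End ℂ JH) (A B : JH) (ν : ℂ) : Module.End ℂ PH where
  toFun P := (φ P.1 - (1 / 3 * ν) • P.1 + (2 : ℂ) • cross B P.2.1 + P.2.2.2 • A,
    (2 : ℂ) • cross A P.1 - transp φ P.2.1 + (1 / 3 * ν) • P.2.1 + P.2.2.1 • B,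
    ip A P.2.1 + ν * P.2.2.1,
    ip B P.1 - ν * P.2.2.2)
  map_add' P Q := by
    ext1
    · simp; module
    ext1
    · simp; module
    ext1
    · simp; ring
    · simp; ring
  map_smul' c P := by
    ext1
    · simp; module
    ext1
    · simp; module
    ext1
    · simp; ring
    · simp; ring

theorem Phi_apply (φ : Module.End ℂ JH) (A B : JH) (ν : ℂ) (X Y : JH) (ξ η : ℂ) :
    Phi φ A B ν (X, Y, ξ, η) = (φ X - (1 / 3 * ν) • X + (2 : ℂ) • cross B Y + η • A,
    (2 : ℂ) • cross A X - transp φ Y + (1 / 3 * ν) • Y + ξ • B,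
    ip A Y + ν * ξ, ip B X - ν * η) := rfl

theorem Phi_add (φ A B ν φ' A' B' ν') : Phi φ A B ν + Phi φ' A' B' ν' =
    Phi (φ + φ') (A + A') (B + B') (ν + ν') := by
  refine LinearMap.ext fun ⟨X, Y, ξ, η⟩ => ?_
  rw [LinearMap.add_apply]
  simp only [Phi_apply, Prod.mk_add_mk, transp_add, map_add, LinearMap.add_apply]
  refine Prod.ext ?_ (Prod.ext ?_ (Prod.ext ?_ ?_))
  · simp only; module
  · simp only; module
  · simp only; ring
  · simp only; ring

theorem Phi_smul (c : ℂ) (φ A B ν) : c • Phi φ A B ν = Phi (c • φ) (c • A) (c • B) (c * ν) := by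
  refine LinearMap.ext fun ⟨X, Y, ξ, η⟩ => ?_
  rw [LinearMap.smul_apply]
  simp only [Phi_apply, Prod.smul_mk, transp_smul, map_smul, LinearMap.smul_apply, smul_eq_mul]
  refine Prod.ext ?_ (Prod.ext ?_ (Prod.ext ?_ ?_))
  · simp only; module
  · simp only; module
  · simp only; ring
  · simp only; ring

theorem transp_lie (φ ψ : Module.End ℂ JH) : transp ⁅φ, ψ⁆ = ⁅transp ψ, transp φ⁆ := by
  ext1 X
  refine ip_ext fun Z => ?_
  rw [ip_transp]
  change ip X (φ (ψ Z) - ψ (φ Z)) = ip (transp ψ (transp φ X) - transp φ (transp ψ X)) Z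
  rw [map_sub, map_sub, LinearMap.sub_apply, ip_transp, ip_transp, ip_transp, ip_transp]

theorem ip_transp' (φ : Module.End ℂ JH) (X Y : JH) : ip X (transp φ Y) = ip (φ X) Y := by
  rw [ip_comm, ip_transp, ip_comm]

theorem ip_cross_swap (X Y Z : JH) : ip X (cross Y Z) = ip Y (cross X Z) := by
  rw [ip_cross, ip_cross, cross_comm]

theorem ip_cross_swap' (X Z : JH) : ip X (cross X Z) = ip Z (cross X X) := by
  rw [ip_cross, ip_comm]

theorem end_lie_apply {M : Type*} [AddCommGroup M] [Module ℂ M] (f g : Module.End ℂ M) (x : M) :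
    ⁅f, g⁆ x = f (g x) - g (f x) := rfl

theorem lie_Phi {φ φ' : Module.End ℂ JH} (h : φ ∈ e6) (h' : φ' ∈ e6) (A B A' B' : JH) (ν ν' : ℂ) :
    ⁅Phi φ A B ν, Phi φ' A' B' ν'⁆ =
      Phi (⁅φ, φ'⁆ + (2 : ℂ) • vee A B' - (2 : ℂ) • vee A' B)
        (φ A' - φ' A + (2 / 3 * ν) • A' - (2 / 3 * ν') • A)
        (transp φ' B - transp φ B' - (2 / 3 * ν) • B' + (2 / 3 * ν') • B)
        (ip A B' - ip A' B) := by
  refine LinearMap.ext fun ⟨X, Y, ξ, η⟩ => ?_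
  have ht : transp (⁅φ, φ'⁆ + (2 : ℂ) • vee A B' - (2 : ℂ) • vee A' B) =
      ⁅transp φ', transp φ⁆ + (2 : ℂ) • vee B' A - (2 : ℂ) • vee B A' := by
    have hs : ∀ a b : Module.End ℂ JH, a - b = a + (-1 : ℂ) • b := fun a b => by module
    rw [hs, hs, transp_add, transp_add, transp_smul, transp_smul, transp_smul, transp_lie, transp_vee, transp_vee]
  have hc : ⁅Phi φ A B ν, Phi φ' A' B' ν'⁆ (X, Y, ξ, η) =
      Phi φ A B ν (Phi φ' A' B' ν' (X, Y, ξ, η)) - Phi φ' A' B' ν' (Phi φ A B ν (X, Y, ξ, η)) := rfl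
  have hl : ∀ (f g : Module.End ℂ JH) Z, ⁅f, g⁆ Z = f (g Z) - g (f Z) := fun _ _ _ => rfl
  rw [hc]
  simp only [Phi_apply, ht, LinearMap.add_apply, LinearMap.sub_apply, LinearMap.smul_apply, hl,
    vee_apply, map_add, map_sub, map_smul, Prod.mk_sub_mk, smul_eq_mul]
  simp only [e6_cross h, e6_cross h', transp_cross h, transp_cross h']
  refine Prod.ext ?_ (Prod.ext ?_ (Prod.ext ?_ ?_))
  · simp only [cross_comm, ip_comm]
    module
  · simp only [cross_comm, ip_comm]
    module
  · simp only [ip_transp']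
    have h1 := ip_cross_swap A A' X
    have h2 := ip_comm A' B
    have h3 := ip_comm A B'
    linear_combination 2 * h1 
  · simp only
    simp only [ip_transp]
    have h1 := ip_cross_swap B B' Y
    have h2 := ip_comm A' B
    have h3 := ip_comm A B'
    linear_combination 2 * h1 - η * h2 + η * h3

/-- The Lie algebra `(e_{7,H})^C` of all `Φ(φ, A, B, ν)` with `φ` in `(e_{6,H})^C`, under the commutator. -/
noncomputable def e7 : LieSubalgebra ℂ (Module.End ℂ PH) where
  carrier := {Φ | ∃ φ ∈ e6, ∃ A B ν, Φ = Phi φ A B ν}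
  add_mem' := by
    rintro _ _ ⟨φ, h, A, B, ν, rfl⟩ ⟨φ', h', A', B', ν', rfl⟩
    exact ⟨_, add_mem h h', _, _, _, Phi_add ..⟩
  zero_mem' := ⟨0, zero_mem _, 0, 0, 0, by
    have := Phi_smul 0 0 0 0 0
    simpa using this⟩
  smul_mem' := by
    rintro c _ ⟨φ, h, A, B, ν, rfl⟩
    exact ⟨_, e6.smul_mem c h, _, _, _, Phi_smul ..⟩
  lie_mem' := by
    rintro _ _ ⟨φ, h, A, B, ν, rfl⟩ ⟨φ', h', A', B', ν', rfl⟩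
    exact ⟨_, sub_mem (add_mem (e6.lie_mem h h') (e6.smul_mem _ (vee_mem _ _)))
      (e6.smul_mem _ (vee_mem _ _)), _, _, _, lie_Phi h h' ..⟩

theorem Phi_mem {φ : Module.End ℂ JH} (h : φ ∈ e6) (A B : JH) (ν : ℂ) : Phi φ A B ν ∈ e7 :=
  ⟨φ, h, A, B, ν, rfl⟩

/-- The Freudenthal cross operation `P × Q = Φ(φ, A, B, ν)`, for `P = (X, Y, ξ, η)` and
`Q = (Z, W, ζ, ω)`, with `φ = -(X ∨ W + Z ∨ Y)/2`, `A = -(2Y × W - ξZ - ζX)/4`,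
`B = (2X × Z - ηW - ωY)/4`, `ν = ((X, W) + (Z, Y) - 3(ξω + ζη))/8`. -/
noncomputable def pcross (P Q : PH) : Module.End ℂ PH :=
  Phi (-(1 / 2 : ℂ) • (vee P.1 Q.2.1 + vee Q.1 P.2.1))
    (-(1 / 4 : ℂ) • ((2 : ℂ) • cross P.2.1 Q.2.1 - P.2.2.1 • Q.1 - Q.2.2.1 • P.1))
    ((1 / 4 : ℂ) • ((2 : ℂ) • cross P.1 Q.1 - P.2.2.2 • Q.2.1 - Q.2.2.2 • P.2.1))
    (1 / 8 * (ip P.1 Q.2.1 + ip Q.1 P.2.1 - 3 * (P.2.2.1 * Q.2.2.2 + Q.2.2.1 * P.2.2.2)))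

theorem pcross_mem (P Q : PH) : pcross P Q ∈ e7 :=
  Phi_mem (e6.smul_mem _ (add_mem (vee_mem _ _) (vee_mem _ _))) _ _ _

theorem pcross_comm (P Q : PH) : pcross P Q = pcross Q P := by
  rw [pcross, pcross]
  congr 1
  · rw [add_comm]
  · rw [cross_comm]; module
  · rw [cross_comm]; module
  · ring

theorem vee_add_left (X X' W : JH) : vee (X + X') W = vee X W + vee X' W := by
  ext1 Z
  simp only [vee_apply, LinearMap.add_apply, map_add]
  module

theorem vee_smul_left (c : ℂ) (X W : JH) : vee (c • X) W = c • vee X W := by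
  ext1 Z
  simp only [vee_apply, LinearMap.smul_apply, map_smul, smul_eq_mul]
  module

theorem vee_add_right (X W W' : JH) : vee X (W + W') = vee X W + vee X W' := by
  ext1 Z
  simp only [vee_apply, LinearMap.add_apply, map_add]
  module

theorem vee_smul_right (c : ℂ) (X W : JH) : vee X (c • W) = c • vee X W := by
  ext1 Z
  simp only [vee_apply, LinearMap.smul_apply, map_smul, smul_eq_mul]
  module

theorem pcross_add_left (P P' Q : PH) : pcross (P + P') Q = pcross P Q + pcross P' Q := by
  rw [pcross, pcross, pcross, Phi_add]
  simp only [Prod.fst_add, Prod.snd_add, vee_add_left, vee_add_right, map_add, LinearMap.add_apply]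
  congr 1
  · module
  · module
  · module
  · ring

theorem pcross_smul_left (c : ℂ) (P Q : PH) : pcross (c • P) Q = c • pcross P Q := by
  rw [pcross, pcross, Phi_smul]
  simp only [Prod.smul_fst, Prod.smul_snd, vee_smul_left, vee_smul_right, map_smul,
    LinearMap.smul_apply, smul_eq_mul]
  congr 1
  · module
  · module
  · module
  · ring

theorem pcross_add_right (P Q Q' : PH) : pcross P (Q + Q') = pcross P Q + pcross P Q' := by
  rw [pcross_comm, pcross_add_left, pcross_comm Q, pcross_comm Q']

theorem pcross_smul_right (c : ℂ) (P Q : PH) : pcross P (c • Q) = c • pcross P Q := by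
  rw [pcross_comm, pcross_smul_left, pcross_comm Q]

theorem skew_e7 {Φ : Module.End ℂ PH} (h : Φ ∈ e7) (P Q : PH) :
    skew (Φ P) Q + skew P (Φ Q) = 0 := by
  obtain ⟨φ, h, A, B, ν, rfl⟩ := h
  obtain ⟨X, Y, ξ, η⟩ := P
  obtain ⟨Z, W, ζ, ω⟩ := Q
  simp only [skew, Phi_apply, map_add, map_sub, map_smul, LinearMap.add_apply, LinearMap.sub_apply,
    LinearMap.smul_apply, smul_eq_mul, ip_transp, ip_transp']
  have h1 := ip_cross B Y W
  have h2 := ip_cross_swap Y B W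
  have h3 := ip_cross A X Z
  have h4 := ip_cross_swap X A Z
  rw [ip_comm Y A, ip_comm X B]
  linear_combination 2 * h3 - 2 * h1 - 2 * h2 + 2 * h4

theorem adj_lin₂ (X A Z : JH) :
    cross (cross A Z) (cross X X) + (2 : ℂ) • cross (cross A X) (cross X Z) =
    (1 / 4 : ℂ) • ((2 * ip A (cross X Z)) • X + ip A (cross X X) • Z + ip Z (cross X X) • A) := by
  have h := fun t : ℂ => adj_lin (X + t • Z) A
  have h0 := h 1
  have h1 := h (-1)
  have h2 := h 2
  have h3 := h (-2)
  have c1 := cross_comm Z X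
  have c2 : ip X (cross X Z) = ip Z (cross X X) := ip_cross_swap' X Z
  have c3 : ip X (cross Z Z) = ip Z (cross X Z) := ip_cross_swap X Z Z
  simp only [map_add, map_smul, LinearMap.add_apply, LinearMap.smul_apply, smul_eq_mul, c1, c2, c3]
    at h0 h1 h2 h3
  linear_combination (norm := module) (2 / 3 : ℂ) • (h0 - h1) - (1 / 12 : ℂ) • (h2 - h3)

theorem vee_cross (A X : JH) : vee A (cross X X) = -(2 : ℂ) • vee X (cross A X) := by
  ext1 Z
  have h := adj_lin₂ X A Z
  have h1 := ip_cross_swap A X X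
  have h2 : ip Z (cross A X) = ip A (cross X Z) := by
    rw [ip_cross_swap, cross_comm]
  simp only [LinearMap.smul_apply, vee_apply]
  rw [cross_comm (cross X X), ip_comm (cross X X), ip_comm (cross A X), h2, ← h1]
  linear_combination (norm := module) (-2 : ℂ) • h

theorem cross_vee (A X : JH) : vee (cross X X) A = -(2 : ℂ) • vee (cross A X) X := by
  rw [← transp_vee, vee_cross, transp_smul, transp_vee]

theorem lie_pcross_self {Φ : Module.End ℂ PH} (h : Φ ∈ e7) (P : PH) :
    ⁅Φ, pcross P P⁆ = (2 : ℂ) • pcross P (Φ P) := by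
  obtain ⟨φ, h, A, B, ν, rfl⟩ := h
  obtain ⟨X, Y, ξ, η⟩ := P
  have hv : -(1 / 2 : ℂ) • (vee X Y + vee X Y) ∈ e6 :=
    e6.smul_mem _ (add_mem (vee_mem _ _) (vee_mem _ _))
  have ht : transp (-(1 / 2 : ℂ) • (vee X Y + vee X Y)) = -(1 / 2 : ℂ) • (vee Y X + vee Y X) := by
    rw [transp_smul, transp_add, transp_vee]
  have hs : ∀ a b : JH, a - b = a + (-1 : ℂ) • b := fun a b => by module
  rw [pcross, pcross, lie_Phi h hv, Phi_smul, ht]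
  simp only [Phi_apply]
  congr 1
  · have hl : ⁅φ, -(1 / 2 : ℂ) • (vee X Y + vee X Y)⁆ = -(vee (φ X) Y - vee X (transp φ Y)) := by
      rw [← lie_vee h]
      ext1 Z
      simp only [end_lie_apply, LinearMap.smul_apply, LinearMap.add_apply, LinearMap.neg_apply,
        map_smul, map_add]
      module
    rw [hl]
    simp only [hs, vee_add_left, vee_add_right, vee_smul_left, vee_smul_right, cross_vee, vee_cross]
    module
  · simp only [map_add, map_sub, map_smul, LinearMap.add_apply, LinearMap.smul_apply,
      LinearMap.sub_apply, vee_apply, e6_cross h, transp_cross h]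
    simp only [cross_comm, ip_comm]
    module
  · simp only [map_add, map_sub, map_smul, LinearMap.add_apply, LinearMap.smul_apply,
      LinearMap.sub_apply, vee_apply, e6_cross h, transp_cross h]
    simp only [cross_comm, ip_comm]
    module
  · simp only [map_add, map_sub, map_smul, LinearMap.add_apply, LinearMap.smul_apply,
      LinearMap.sub_apply, smul_eq_mul, ip_transp']
    have h1 := ip_cross_swap A X X
    have h2 := ip_comm (cross Y Y) B
    have h3 := ip_cross B Y Y
    rw [h2, ← h3, ← h1, ip_comm X B]
    ring

theorem lie_pcross {Φ : Module.End ℂ PH} (h : Φ ∈ e7) (P Q : PH) :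
    ⁅Φ, pcross P Q⁆ = pcross (Φ P) Q + pcross P (Φ Q) := by
  refine LinearMap.ext fun R => ?_
  have h1 := LinearMap.congr_fun (lie_pcross_self h (P + Q)) R
  have h2 := LinearMap.congr_fun (lie_pcross_self h P) R
  have h3 := LinearMap.congr_fun (lie_pcross_self h Q) R
  rw [pcross_comm (Φ P)]
  simp only [pcross_add_left, pcross_add_right, map_add, end_lie_apply, pcross_comm Q P,
    LinearMap.add_apply, LinearMap.smul_apply] at h1 h2 h3 ⊢
  linear_combination (norm := module) (1 / 2 : ℂ) • (h1 - h2 - h3)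

theorem pcross_apply_sub (P Q R : PH) : pcross P Q R - pcross R Q P =
    (1 / 8 * skew P Q) • R - (1 / 8 * skew R Q) • P + (1 / 4 * skew P R) • Q := by
  obtain ⟨X, Y, ξ, η⟩ := P
  obtain ⟨Z, W, ζ, ω⟩ := Q
  obtain ⟨U, V, α, β⟩ := R
  have ht : ∀ (c : ℂ) (X W X' W' : JH), transp (c • (vee X W + vee X' W')) =
      c • (vee W X + vee W' X') := fun c X W X' W' => by
    rw [transp_smul, transp_add, transp_vee, transp_vee]
  simp only [pcross, skew, Phi_apply, ht, LinearMap.add_apply, LinearMap.sub_apply, LinearMap.smul_apply,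
    vee_apply, map_add, map_sub, map_smul, Prod.mk_sub_mk, smul_eq_mul, Prod.smul_mk, Prod.mk_add_mk]
  refine Prod.ext ?_ (Prod.ext ?_ (Prod.ext ?_ ?_))
  · simp only [cross_comm, ip_comm]
    module
  · simp only [cross_comm, ip_comm]
    module
  · simp only
    have h1 : ip (cross Y W) V = ip (cross V W) Y := by rw [← ip_cross, ip_comm, cross_comm]
    rw [h1, ip_comm V Z, ip_comm Y Z, ip_comm Y U]
    ring
  · simp only
    have h1 : ip (cross X Z) U = ip (cross U Z) X := by rw [← ip_cross, ip_comm, cross_comm]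
    rw [h1, ip_comm W U, ip_comm W X, ip_comm V X, ip_comm V Z, ip_comm Y Z]
    ring

/-- The component `ν` of `Φ = Φ(φ, A, B, ν)`, read off from a value of `Φ` (see `nuPart_Phi`). -/
noncomputable def nuPart (Φ : Module.End ℂ PH) : ℂ := (Φ (0, 0, 1, 0)).2.2.1

/-- The component `A` of `Φ(φ, A, B, ν)` (see `APart_Phi`). -/
noncomputable def APart (Φ : Module.End ℂ PH) : JH := (Φ (0, 0, 0, 1)).1

/-- The component `B` of `Φ(φ, A, B, ν)` (see `BPart_Phi`). -/
noncomputable def BPart (Φ : Module.End ℂ PH) : JH := (Φ (0, 0, 1, 0)).2.1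

/-- The component `φ` of `Φ(φ, A, B, ν)` (see `phiPart_Phi`). -/
noncomputable def phiPart (Φ : Module.End ℂ PH) : Module.End ℂ JH where
  toFun X := (Φ (X, 0, 0, 0)).1 + (1 / 3 * nuPart Φ) • X
  map_add' X Y := by
    have : ((X + Y, 0, 0, 0) : PH) = (X, 0, 0, 0) + (Y, 0, 0, 0) := by simp
    rw [this, map_add, Prod.fst_add]; module
  map_smul' c X := by
    have : ((c • X, 0, 0, 0) : PH) = c • (X, 0, 0, 0) := by simp
    rw [this, map_smul, Prod.smul_fst, RingHom.id_apply]; module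

theorem nuPart_Phi (φ A B ν) : nuPart (Phi φ A B ν) = ν := by simp [nuPart, Phi_apply]

theorem APart_Phi (φ A B ν) : APart (Phi φ A B ν) = A := by simp [APart, Phi_apply]

theorem BPart_Phi (φ A B ν) : BPart (Phi φ A B ν) = B := by simp [BPart, Phi_apply]

theorem phiPart_Phi (φ A B ν) : phiPart (Phi φ A B ν) = φ := by
  ext1 X
  change ((Phi φ A B ν) (X, 0, 0, 0)).1 + (1 / 3 * nuPart (Phi φ A B ν)) • X = φ X
  rw [nuPart_Phi, Phi_apply]
  simp

theorem phiPart_mem (Φ : e7) : phiPart Φ.1 ∈ e6 := by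
  obtain ⟨_, φ, h, A, B, ν, rfl⟩ := Φ
  change phiPart (Phi φ A B ν) ∈ e6
  rwa [phiPart_Phi]

theorem Phi_parts (Φ : e7) :
    Phi (phiPart Φ.1) (APart Φ.1) (BPart Φ.1) (nuPart Φ.1) = Φ.1 := by
  obtain ⟨_, φ, h, A, B, ν, rfl⟩ := Φ
  change Phi (phiPart (Phi φ A B ν)) (APart (Phi φ A B ν)) (BPart (Phi φ A B ν)) (nuPart (Phi φ A B ν)) = Phi φ A B ν
  rw [phiPart_Phi, APart_Phi, BPart_Phi, nuPart_Phi]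

/-- The form `(Φ₁, Φ₂)_7 = -2(φ₁, φ₂)_6 - 4(A₁, B₂) - 4(A₂, B₁) - (8/3)ν₁ν₂` on `(e_{7,H})^C`, where
`Φᵢ = Φ(φᵢ, Aᵢ, Bᵢ, νᵢ)`. -/
noncomputable def form7 (Φ₁ Φ₂ : e7) : ℂ :=
  -2 * form6 ⟨phiPart Φ₁.1, phiPart_mem Φ₁⟩ ⟨phiPart Φ₂.1, phiPart_mem Φ₂⟩
    - 4 * ip (APart Φ₁.1) (BPart Φ₂.1) - 4 * ip (APart Φ₂.1) (BPart Φ₁.1)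
    - 8 / 3 * (nuPart Φ₁.1 * nuPart Φ₂.1)

theorem form7_Phi {φ φ' : Module.End ℂ JH} (h : φ ∈ e6) (h' : φ' ∈ e6) (A B A' B' : JH) (ν ν' : ℂ) :
    form7 ⟨Phi φ A B ν, Phi_mem h A B ν⟩ ⟨Phi φ' A' B' ν', Phi_mem h' A' B' ν'⟩ =
      -2 * form6 ⟨φ, h⟩ ⟨φ', h'⟩ - 4 * ip A B' - 4 * ip A' B - 8 / 3 * (ν * ν') := by
  simp only [form7, phiPart_Phi, APart_Phi, BPart_Phi, nuPart_Phi]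

/-- `P × Q` as an element of `(e_{7,H})^C`. -/
noncomputable def pc (P Q : PH) : e7 := ⟨pcross P Q, pcross_mem P Q⟩

/-- The space `(e_{8,H})^C` of all `R = (Φ, P, Q, r, s, t)`; it is a Lie algebra by the instances below. -/
@[ext] structure E8 : Type where
  Φ : e7
  P : PH
  Q : PH
  r : ℂ
  s : ℂ
  t : ℂ

namespace E8

/-- `(e_{8,H})^C` as a direct sum. -/
noncomputable def equivProd : E8 ≃ e7 × PH × PH × ℂ × ℂ × ℂ where
  toFun R := (R.Φ, R.P, R.Q, R.r, R.s, R.t)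
  invFun p := ⟨p.1, p.2.1, p.2.2.1, p.2.2.2.1, p.2.2.2.2.1, p.2.2.2.2.2⟩

noncomputable instance : AddCommGroup E8 := equivProd.addCommGroup

noncomputable instance : Module ℂ E8 := equivProd.module ℂ

theorem add_def (R S : E8) :
    R + S = ⟨R.Φ + S.Φ, R.P + S.P, R.Q + S.Q, R.r + S.r, R.s + S.s, R.t + S.t⟩ := rfl

theorem zero_def : (0 : E8) = ⟨0, 0, 0, 0, 0, 0⟩ := rfl

theorem smul_def (c : ℂ) (R : E8) :
    c • R = ⟨c • R.Φ, c • R.P, c • R.Q, c * R.r, c * R.s, c * R.t⟩ := rfl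

/-- The Lie bracket of `(e_{8,H})^C`. -/
noncomputable instance : Bracket E8 E8 where
  bracket R₁ R₂ :=
    { Φ := ⁅R₁.Φ, R₂.Φ⁆ + pc R₁.P R₂.Q - pc R₂.P R₁.Q
      P := R₁.Φ.1 R₂.P - R₂.Φ.1 R₁.P + R₁.r • R₂.P - R₂.r • R₁.P + R₁.s • R₂.Q - R₂.s • R₁.Q
      Q := R₁.Φ.1 R₂.Q - R₂.Φ.1 R₁.Q - R₁.r • R₂.Q + R₂.r • R₁.Q + R₁.t • R₂.P - R₂.t • R₁.P
      r := -(1 / 8) * skew R₁.P R₂.Q + 1 / 8 * skew R₂.P R₁.Q + R₁.s * R₂.t - R₂.s * R₁.t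
      s := 1 / 4 * skew R₁.P R₂.P + 2 * R₁.r * R₂.s - 2 * R₂.r * R₁.s
      t := -(1 / 4) * skew R₁.Q R₂.Q - 2 * R₁.r * R₂.t + 2 * R₂.r * R₁.t }

theorem lie_def (R₁ R₂ : E8) : ⁅R₁, R₂⁆ =
    { Φ := ⁅R₁.Φ, R₂.Φ⁆ + pc R₁.P R₂.Q - pc R₂.P R₁.Q
      P := R₁.Φ.1 R₂.P - R₂.Φ.1 R₁.P + R₁.r • R₂.P - R₂.r • R₁.P + R₁.s • R₂.Q - R₂.s • R₁.Q
      Q := R₁.Φ.1 R₂.Q - R₂.Φ.1 R₁.Q - R₁.r • R₂.Q + R₂.r • R₁.Q + R₁.t • R₂.P - R₂.t • R₁.P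
      r := -(1 / 8) * skew R₁.P R₂.Q + 1 / 8 * skew R₂.P R₁.Q + R₁.s * R₂.t - R₂.s * R₁.t
      s := 1 / 4 * skew R₁.P R₂.P + 2 * R₁.r * R₂.s - 2 * R₂.r * R₁.s
      t := -(1 / 4) * skew R₁.Q R₂.Q - 2 * R₁.r * R₂.t + 2 * R₂.r * R₁.t } := rfl

theorem ext_apply {R S : E8} (h : ∀ V, R.Φ.1 V = S.Φ.1 V) (hP : R.P = S.P) (hQ : R.Q = S.Q)
    (hr : R.r = S.r) (hs : R.s = S.s) (ht : R.t = S.t) : R = S :=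
  E8.ext (Subtype.ext (LinearMap.ext h)) hP hQ hr hs ht

end E8

theorem skew_add_left (P P' Q : PH) : skew (P + P') Q = skew P Q + skew P' Q := by
  simp only [skew, Prod.fst_add, Prod.snd_add, map_add, LinearMap.add_apply]; ring

theorem skew_smul_left (c : ℂ) (P Q : PH) : skew (c • P) Q = c * skew P Q := by
  simp only [skew, Prod.smul_fst, Prod.smul_snd, map_smul, LinearMap.smul_apply, smul_eq_mul]; ring

theorem skew_comm (P Q : PH) : skew P Q = -skew Q P := by
  simp only [skew]; rw [ip_comm Q.1, ip_comm Q.2.1]; ring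

theorem skew_add_right (P Q Q' : PH) : skew P (Q + Q') = skew P Q + skew P Q' := by
  rw [skew_comm, skew_add_left, skew_comm Q, skew_comm Q']; ring

theorem skew_smul_right (c : ℂ) (P Q : PH) : skew P (c • Q) = c * skew P Q := by
  rw [skew_comm, skew_smul_left, skew_comm Q]; ring

theorem skew_sub_left (P P' Q : PH) : skew (P - P') Q = skew P Q - skew P' Q := by
  simp only [skew, Prod.fst_sub, Prod.snd_sub, map_sub, LinearMap.sub_apply]; ring

theorem skew_sub_right (P Q Q' : PH) : skew P (Q - Q') = skew P Q - skew P Q' := by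
  rw [skew_comm, skew_sub_left, skew_comm Q, skew_comm Q']; ring

theorem pcross_sub_left (P P' Q : PH) : pcross (P - P') Q = pcross P Q - pcross P' Q := by
  have h : P - P' = P + (-1 : ℂ) • P' := by module
  rw [h, pcross_add_left, pcross_smul_left]; module

theorem pcross_sub_right (P Q Q' : PH) : pcross P (Q - Q') = pcross P Q - pcross P Q' := by
  rw [pcross_comm, pcross_sub_left, pcross_comm Q, pcross_comm Q']

theorem coe_pc (P Q : PH) : (pc P Q).1 = pcross P Q := rfl

theorem e7_lie_apply (Φ Ψ : e7) (V : PH) : ⁅Φ, Ψ⁆.1 V = Φ.1 (Ψ.1 V) - Ψ.1 (Φ.1 V) := rfl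

theorem e7_add_apply (Φ Ψ : e7) (V : PH) : (Φ + Ψ).1 V = Φ.1 V + Ψ.1 V := rfl

theorem e7_sub_apply (Φ Ψ : e7) (V : PH) : (Φ - Ψ).1 V = Φ.1 V - Ψ.1 V := rfl

theorem e7_smul_apply (c : ℂ) (Φ : e7) (V : PH) : (c • Φ).1 V = c • Φ.1 V := rfl

theorem e7_pcross_apply (Φ : e7) (P Q V : PH) : Φ.1 (pcross P Q V) =
    pcross (Φ.1 P) Q V + pcross P (Φ.1 Q) V + pcross P Q (Φ.1 V) := by
  have h := LinearMap.congr_fun (lie_pcross Φ.2 P Q) V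
  rw [end_lie_apply, LinearMap.add_apply] at h
  linear_combination (norm := module) h

theorem skew_e7' (Φ : e7) (P Q : PH) : skew (Φ.1 P) Q = -skew P (Φ.1 Q) :=
  eq_neg_of_add_eq_zero_left (skew_e7 Φ.2 P Q)

theorem skew_e7_symm (Φ : e7) (P Q : PH) : skew P (Φ.1 Q) = skew Q (Φ.1 P) := by
  rw [skew_comm, skew_e7', neg_neg]

namespace E8

noncomputable instance : LieRing E8 where
  add_lie R S T := by
    simp only [lie_def, add_def]
    refine ext_apply (fun V => ?_) ?_ ?_ ?_ ?_ ?_ <;>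
      simp only [e7_lie_apply, e7_add_apply, e7_sub_apply, coe_pc, pcross_add_left, pcross_add_right,
        map_add, LinearMap.add_apply, skew_add_left, skew_add_right]
    · module
    · module
    · module
    · ring
    · ring
    · ring
  lie_add R S T := by
    simp only [lie_def, add_def]
    refine ext_apply (fun V => ?_) ?_ ?_ ?_ ?_ ?_ <;>
      simp only [e7_lie_apply, e7_add_apply, e7_sub_apply, coe_pc, pcross_add_left, pcross_add_right,
        map_add, LinearMap.add_apply, skew_add_left, skew_add_right]
    · module
    · module
    · module
    · ring
    · ring
    · ring
  lie_self R := by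
    have h : ∀ P : PH, skew P P = 0 := fun P => by
      simp only [skew]; rw [ip_comm P.2.1]; ring
    simp only [lie_def, zero_def]
    refine E8.ext ?_ ?_ ?_ ?_ ?_ ?_ <;> simp only [lie_self, h]
    · simp
    · module
    · module
    · ring
    · ring
    · ring
  leibniz_lie R S T := by
    simp only [lie_def, add_def]
    refine ext_apply (fun V => ?_) ?_ ?_ ?_ ?_ ?_
    · simp only [e7_lie_apply, e7_add_apply, e7_sub_apply, coe_pc, pcross_add_left, pcross_add_right,
        pcross_sub_left, pcross_sub_right, pcross_smul_left, pcross_smul_right, e7_pcross_apply,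
        map_add, map_sub, LinearMap.add_apply, LinearMap.sub_apply, LinearMap.smul_apply]
      simp only [pcross_comm]
      module
    · have h1 := pcross_apply_sub R.P T.Q S.P
      have h2 := pcross_apply_sub S.P R.Q T.P
      have h3 := pcross_apply_sub T.P S.Q R.P
      rw [skew_comm T.P R.P] at h3
      simp only [e7_lie_apply, e7_add_apply, e7_sub_apply, coe_pc,
        map_add, map_sub, map_smul]
      linear_combination (norm := module) h1 + h2 + h3
    · have h1 := pcross_apply_sub R.Q S.P T.Q
      have h2 := pcross_apply_sub S.Q T.P R.Q
      have h3 := pcross_apply_sub T.Q R.P S.Q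
      rw [pcross_comm R.Q, pcross_comm T.Q, skew_comm R.Q S.P, skew_comm T.Q S.P] at h1
      rw [pcross_comm R.Q, pcross_comm S.Q, skew_comm R.Q T.P, skew_comm S.Q T.P,
        skew_comm S.Q R.Q] at h2
      rw [pcross_comm S.Q, pcross_comm T.Q, skew_comm S.Q R.P, skew_comm T.Q R.P,
        skew_comm T.Q S.Q] at h3
      simp only [e7_lie_apply, e7_add_apply, e7_sub_apply, coe_pc,
        map_add, map_sub, map_smul]
      linear_combination (norm := module) h1 + h2 + h3
    all_goals
      simp only [skew_add_left, skew_add_right, skew_sub_left, skew_sub_right, skew_smul_left,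
        skew_smul_right, skew_e7']
      simp only [skew_comm T.P R.P, skew_comm T.P S.P, skew_comm S.P R.P, skew_comm T.Q R.Q,
        skew_comm T.Q S.Q, skew_comm S.Q R.Q, skew_comm R.Q S.P, skew_comm R.Q T.P,
        skew_comm S.Q R.P, skew_comm S.Q T.P, skew_comm T.Q R.P, skew_comm T.Q S.P,
        skew_e7_symm R.Φ T.P S.P, skew_e7_symm R.Φ T.Q S.Q, skew_e7_symm R.Φ S.Q S.P,
        skew_e7_symm R.Φ S.Q T.P, skew_e7_symm R.Φ T.Q S.P, skew_e7_symm R.Φ T.Q T.P,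
        skew_e7_symm S.Φ T.P R.P, skew_e7_symm S.Φ T.Q R.Q, skew_e7_symm S.Φ R.Q R.P,
        skew_e7_symm S.Φ R.Q T.P, skew_e7_symm S.Φ T.Q R.P, skew_e7_symm S.Φ T.Q T.P,
        skew_e7_symm T.Φ S.P R.P, skew_e7_symm T.Φ S.Q R.Q, skew_e7_symm T.Φ R.Q R.P,
        skew_e7_symm T.Φ R.Q S.P, skew_e7_symm T.Φ S.Q R.P, skew_e7_symm T.Φ S.Q S.P]
      ring

noncomputable instance : LieAlgebra ℂ E8 where
  lie_smul c R S := by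
    simp only [lie_def, smul_def]
    refine ext_apply (fun V => ?_) ?_ ?_ ?_ ?_ ?_ <;>
      simp only [e7_lie_apply, e7_add_apply, e7_sub_apply, e7_smul_apply, coe_pc, pcross_smul_left,
        pcross_smul_right, map_smul, LinearMap.smul_apply, skew_smul_left, skew_smul_right]
    · module
    · module
    · module
    · ring
    · ring
    · ring

/-- The form
`(R₁, R₂)_8 = (Φ₁, Φ₂)_7 - {Q₁, P₂} + {P₁, Q₂} - 8r₁r₂ - 4t₁s₂ - 4s₁t₂` on `(e_{8,H})^C`. -/
noncomputable def form8 (R₁ R₂ : E8) : ℂ :=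
  form7 R₁.Φ R₂.Φ - skew R₁.Q R₂.P + skew R₁.P R₂.Q
    - 8 * (R₁.r * R₂.r) - 4 * (R₁.t * R₂.s) - 4 * (R₁.s * R₂.t)

end E8

end QuatE8

namespace QuatE8

/-! ### The Lie algebras `f₄` and `e₆` -/

/-! The Killing form κ is invariant, so each grading element reduces most of it to very few traces.
If `[h, x] = a x` and `[h, y] = b y`, then κ(x, y) = 0 unless a + b = 0, and a κ(x, y) = κ(h, [x,
y]) for every y (`killingForm_eq_zero_of_lie_eq`, `mul_killingForm_of_lie_eq`).

In e₈ take h with r = 1 and all other coordinates 0. It acts by 1, -1, 2, -2 on P, Q, s, t and by 0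
on Φ and r, so κ(h, h) = 32 + 32 + 4 + 4 = 72. Since h = [s, t] for s = t = 1, and the t-line
commutes with e₇, h is orthogonal to e₇. The s–t pairing 72/2 = 36 and the P–Q pairing -72/8 = -9
(times the skew form) now follow from the brackets `[s, t]` and `[P, Q]`.

On e₇ itself no further trace is needed. The e₇-part of `[P, Q]` is P × Q, so invariance gives κ(Φ,
P × Q) = κ(ΦP, Q) = -9{ΦP, Q} (`killingForm_inPhi_pc`). The products P × Q span e₇, and this value
agrees with -9 times the form of e₇ on suitable generators. For the e₆-part the generators are the X
∨ W: they span e₆ (`e6_le_of_vee_mem`) and satisfy (φ, X ∨ W)_6 = (φX, W) (`form6_vee`), which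
determines the form.

The Killing form of e₇, needed only for the last expression, is found in the same way from h = Φ(0,
0, 0, 1), with weights 2/3, -2/3, 0 on A, B and the rest. The trace input is that elements of e₆
have trace zero on the 15-dimensional J (`trace_e6`, `killingForm_grad7_mk7`). The result is -5
times the form of e₇, whence the factor 9/5. -/

theorem L_E : L E = 1 := by
  ext1 Z
  exact jmul_E Z

/-- Since `L E` is the identity, the trace formula for `L E * L E` computes the dimension: 2 · 3 +
3² = 15. No basis is needed. -/
theorem finrank_JH : Module.finrank ℂ JH = 15 := by
  have h := trace_L_L E E
  rw [L_E, mul_one, LinearMap.trace_one, ip_E, tr_E] at h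
  norm_num at h
  exact_mod_cast h

theorem trace_L (T : JH) : LinearMap.trace ℂ JH (L T) = 5 * tr T := by
  have h := trace_L_L T E
  rw [L_E, mul_one, ip_E, tr_E] at h
  rw [h]
  ring

/-- `(δ₁, δ₂)_4` as a linear functional of `δ₂`. -/
noncomputable def form4Hom (δ : f4) : f4 →ₗ[ℂ] ℂ where
  toFun ε := form4 δ ε
  map_add' a b := by simp [form4, mul_add]
  map_smul' c a := by simp [form4]; ring

/-- `f₄` is spanned by the commutators `[Ã, B̃]`. -/
theorem f4_span : Submodule.span ℂ {x : f4 | ∃ A B, x = ⟨⁅L A, L B⁆, lie_L_mem A B⟩} = ⊤ := by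
  by_contra hne
  obtain ⟨g, hg0, hg⟩ := Submodule.exists_le_ker_of_lt_top _ (lt_top_iff_ne_top.2 hne)
  -- Nondegeneracy of the form: pairing with `[Ã, B̃]` recovers every matrix coefficient (δA, B).
  have hz : ∀ δ : f4, (∀ ε, form4 δ ε = 0) → δ = 0 := fun δ h => by
    apply Subtype.ext
    ext1 A
    exact ip_eq_zero fun B => by rw [← form4_lie_L δ A B, h]
  let F : f4 →ₗ[ℂ] Module.Dual ℂ f4 :=
    { toFun := form4Hom
      map_add' := fun a b => LinearMap.ext fun x => by
        change form4 _ _ = form4 _ _ + form4 _ _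
        simp [form4, add_mul, mul_add]
      map_smul' := fun c a => LinearMap.ext fun x => by
        change form4 _ _ = c * form4 _ _
        simp [form4]; ring }
  have hinj : Function.Injective F := by
    rw [← LinearMap.ker_eq_bot, LinearMap.ker_eq_bot']
    exact fun m hm => hz m fun ε => LinearMap.congr_fun hm ε
  -- By finite dimension every functional is (m, ·)_4, in particular the nonzero one that kills the
  -- span. Vanishing on all `[Ã, B̃]` then means (mA, B) = 0, so m = 0.
  obtain ⟨m, rfl⟩ := (LinearMap.injective_iff_surjective_of_finrank_eq_finrank
      (Subspace.dual_finrank_eq (K := ℂ) (V := f4)).symm).1 hinj g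
  apply hg0
  have hm : m = 0 := by
    apply Subtype.ext
    ext1 A
    refine ip_eq_zero fun B => ?_
    rw [← form4_lie_L m A B]
    exact hg (Submodule.subset_span ⟨A, B, rfl⟩)
  rw [hm, map_zero]

/-- The commutator part disappears because multiplication by E is the identity. For traceless T this
exhibits the multiplication by T among the operators X ∨ W. -/
theorem vee_E (T : JH) : vee T E = L (T - (1 / 3 * tr T) • E) := by
  rw [vee, L_E, jmul_E', ip_E, Ring.lie_def, mul_one, one_mul, sub_self, zero_add]

theorem L_add (X Y : JH) : L (X + Y) = L X + L Y := map_add jmul X Y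

theorem L_smul (c : ℂ) (X : JH) : L (c • X) = c • L X := map_smul jmul c X

theorem tr_e6_E {φ : Module.End ℂ JH} (h : φ ∈ e6) : tr (φ E) = 0 := by
  have := h E
  rwa [cross_E_E, ip_E] at this

/-- A linear subspace of `End J` that contains all `X ∨ W` contains `e₆`. -/
theorem e6_le_of_vee_mem {S : Submodule ℂ (Module.End ℂ JH)} (hS : ∀ X W, vee X W ∈ S)
    {φ : Module.End ℂ JH} (h : φ ∈ e6) : φ ∈ S := by
  -- The two summands of e₆ are reached separately: W = E gives the traceless multiplications, and
  -- subtracting these from A ∨ B leaves the commutators, which span f₄.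
  have hL : ∀ T, tr T = 0 → L T ∈ S := fun T hT => by
    have := hS T E
    rwa [vee_E, hT, mul_zero, zero_smul, sub_zero] at this
  have hlie : ∀ A B, ⁅L A, L B⁆ ∈ S := fun A B => by
    have h0 : tr (jmul A B - (1 / 3 * ip A B) • E) = 0 := by
      have : tr (jmul A B) = ip A B := rfl
      rw [map_sub, map_smul, tr_E, this, smul_eq_mul]; ring
    have h1 : ⁅L A, L B⁆ = vee A B + (-1 : ℂ) • L (jmul A B - (1 / 3 * ip A B) • E) := by
      rw [vee]; module
    rw [h1]
    exact S.add_mem (hS A B) (S.smul_mem _ (hL _ h0))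
  have hf : Submodule.span ℂ {x : f4 | ∃ A B, x = ⟨⁅L A, L B⁆, lie_L_mem A B⟩} ≤
      S.comap f4.toSubmodule.subtype := Submodule.span_le.2 (by
    rintro _ ⟨A, B, rfl⟩
    exact hlie A B)
  rw [f4_span] at hf
  have h1 : φ - L (φ E) ∈ S := hf (Submodule.mem_top (x := (⟨_, delta_mem h⟩ : f4)))
  have h2 := S.add_mem h1 (hL (φ E) (tr_e6_E h))
  have h3 : φ - L (φ E) + L (φ E) = φ := by module
  rwa [h3] at h2

/-- It is enough to test X ∨ W: a commutator has trace zero, and the multiplication by T has trace 5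
tr T, which vanishes for the traceless T occurring there. -/
theorem trace_e6 {φ : Module.End ℂ JH} (h : φ ∈ e6) : LinearMap.trace ℂ JH φ = 0 := by
  refine e6_le_of_vee_mem (S := LinearMap.ker (LinearMap.trace ℂ JH)) (fun X W => ?_) h
  have : tr (jmul X W) = ip X W := rfl
  rw [LinearMap.mem_ker, vee, map_add, Ring.lie_def, map_sub, LinearMap.trace_mul_comm, sub_self,
    trace_L, map_sub, map_smul, tr_E, this, smul_eq_mul]
  ring

theorem vee_apply_E (X W : JH) : vee X W E = jmul X W - (1 / 3 * ip X W) • E := by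
  have h : vee X W E = jmul X (jmul W E) - jmul W (jmul X E)
      + jmul (jmul X W - (1 / 3 * ip X W) • E) E := rfl
  rw [h, jmul_E', jmul_E', jmul_E', jmul_comm W X, sub_self, zero_add]

/-- With φ = δ + T̃, the derivation part of X ∨ W is `[X̃, W̃]` and contributes (δX, W). The
multiplication part contributes (T, X ∘ W) = (T ∘ X, W), the multiple of E being invisible to the
traceless T. The sum is (φX, W). -/
theorem form6_vee (φ : e6) (X W : JH) : form6 φ ⟨vee X W, vee_mem X W⟩ = ip (φ.1 X) W := by
  have h1 : (⟨vee X W - L (vee X W E), delta_mem (vee_mem X W)⟩ : f4) =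
      ⟨⁅L X, L W⁆, lie_L_mem X W⟩ := by
    apply Subtype.ext
    change vee X W - L (vee X W E) = _
    rw [vee_apply_E, vee]; module
  have h2 : (φ.1 - L (φ.1 E)) X = φ.1 X - jmul (φ.1 E) X := rfl
  have h3 := jmul_assoc_ip X (φ.1 E) W
  rw [form6]
  simp only [h1]
  rw [form4_lie_L, vee_apply_E]
  simp only [h2, map_sub, map_smul, LinearMap.sub_apply, ip_E, tr_e6_E φ.2, smul_zero, sub_zero]
  rw [jmul_comm, h3, sub_add_cancel]

theorem form6_add_right (φ ψ ψ' : e6) : form6 φ (ψ + ψ') = form6 φ ψ + form6 φ ψ' := by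
  have h1 : (φ.1 - L (φ.1 E)) * ((ψ + ψ').1 - L ((ψ + ψ').1 E)) =
      (φ.1 - L (φ.1 E)) * (ψ.1 - L (ψ.1 E)) + (φ.1 - L (φ.1 E)) * (ψ'.1 - L (ψ'.1 E)) := by
    rw [← mul_add (φ.1 - L (φ.1 E))]
    congr 1
    change ψ.1 + ψ'.1 - L (ψ.1 E + ψ'.1 E) = _
    rw [L_add]
    module
  have h2 : (ψ + ψ').1 E = ψ.1 E + ψ'.1 E := rfl
  rw [form6, form6, form6, form4, form4, form4]
  simp only [h1]
  rw [h2, map_add (LinearMap.trace ℂ JH), map_add]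
  ring

theorem form6_smul_right (c : ℂ) (φ ψ : e6) : form6 φ (c • ψ) = c * form6 φ ψ := by
  have h1 : (φ.1 - L (φ.1 E)) * ((c • ψ).1 - L ((c • ψ).1 E)) =
      c • ((φ.1 - L (φ.1 E)) * (ψ.1 - L (ψ.1 E))) := by
    rw [← mul_smul_comm c (φ.1 - L (φ.1 E))]
    congr 1
    change c • ψ.1 - L (c • ψ.1 E) = _
    rw [L_smul]
    module
  have h2 : (c • ψ).1 E = c • ψ.1 E := rfl
  rw [form6, form6, form4, form4]
  simp only [h1]
  rw [h2, map_smul (LinearMap.trace ℂ JH), map_smul, smul_eq_mul, smul_eq_mul]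
  ring

/-- A linear functional on `e₆` that agrees with `c (φ, ·)_6` on every `X ∨ W` agrees with it. -/
theorem form6_unique (φ : e6) (c : ℂ) (f : e6 →ₗ[ℂ] ℂ)
    (h : ∀ X W, f ⟨vee X W, vee_mem X W⟩ = c * ip (φ.1 X) W) (ψ : e6) : f ψ = c * form6 φ ψ := by
  let g : e6 →ₗ[ℂ] ℂ :=
    { toFun := fun ψ => f ψ - c * form6 φ ψ
      map_add' := fun a b => by rw [map_add, form6_add_right]; ring
      map_smul' := fun a b => by
        rw [map_smul, form6_smul_right, smul_eq_mul, RingHom.id_apply, smul_eq_mul]; ring }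
  -- The kernel of the difference functional, viewed inside End J, contains every X ∨ W and hence
  -- all of e₆.
  have hS := e6_le_of_vee_mem (S := (LinearMap.ker g).map e6.toSubmodule.subtype) (fun X W =>
    ⟨⟨vee X W, vee_mem X W⟩, by
      change f _ - c * form6 _ _ = 0
      rw [h, form6_vee, sub_self], rfl⟩) ψ.2
  obtain ⟨ψ', h1, h2⟩ := hS
  obtain rfl : ψ' = ψ := Subtype.ext h2
  exact sub_eq_zero.1 h1

/-! ### Killing forms and weight vectors -/

section Killing

variable {𝔤 : Type*} [LieRing 𝔤] [LieAlgebra ℂ 𝔤]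

theorem killingForm_lie_apply (x y z : 𝔤) : killingForm ℂ 𝔤 ⁅x, y⁆ z = killingForm ℂ 𝔤 x ⁅y, z⁆ :=
  LieModule.traceForm_apply_lie_apply ℂ 𝔤 𝔤 x y z

theorem killingForm_comm (x y : 𝔤) : killingForm ℂ 𝔤 x y = killingForm ℂ 𝔤 y x :=
  LieModule.traceForm_comm ℂ 𝔤 𝔤 x y

/-- If `[h, x] = a x` then `a κ(x, y) = κ(h, [x, y])`. -/
theorem mul_killingForm_of_lie_eq {h x : 𝔤} {a : ℂ} (hx : ⁅h, x⁆ = a • x) (y : 𝔤) :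
    a * killingForm ℂ 𝔤 x y = killingForm ℂ 𝔤 h ⁅x, y⁆ := by
  rw [← killingForm_lie_apply, hx, map_smul, LinearMap.smul_apply, smul_eq_mul]

/-- Weight vectors whose weights do not add up to zero are orthogonal. -/
theorem killingForm_eq_zero_of_lie_eq {h x y : 𝔤} {a b : ℂ} (hx : ⁅h, x⁆ = a • x)
    (hy : ⁅h, y⁆ = b • y) (hab : a + b ≠ 0) : killingForm ℂ 𝔤 x y = 0 := by
  -- Moving h from one argument to the other gives -a κ(x, y) = b κ(x, y).
  have h1 := killingForm_lie_apply x h y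
  rw [← lie_skew, hx, hy, map_neg, LinearMap.neg_apply, map_smul, LinearMap.smul_apply,
    map_smul, smul_eq_mul, smul_eq_mul] at h1
  have h2 : (a + b) * killingForm ℂ 𝔤 x y = 0 := by linear_combination -h1
  exact (mul_eq_zero.1 h2).resolve_left hab

end Killing

/-- Cyclicity of the trace. The operator on W is f on the summand i(V) and zero on the complement
ker p, so products of `ad`'s that are block diagonal can be traced one block at a time. -/
theorem trace_conj_of_leftInverse {V W : Type*} [AddCommGroup V] [Module ℂ V] [Module.Finite ℂ V]
    [AddCommGroup W] [Module ℂ W] [Module.Finite ℂ W] (i : V →ₗ[ℂ] W) (p : W →ₗ[ℂ] V)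
    (hpi : ∀ v, p (i v) = v) (f : Module.End ℂ V) :
    LinearMap.trace ℂ W (i ∘ₗ f ∘ₗ p) = LinearMap.trace ℂ V f := by
  rw [LinearMap.trace_comp_comm']
  congr 1
  ext1 v
  exact congrArg f (hpi v)

/-! ### The Killing form of `e₇` -/

/-- `X ∨ W` as an element of `e₆`. -/
noncomputable def vee6 (X W : JH) : e6 := ⟨vee X W, vee_mem X W⟩

/-- The form of `form6_unique` suited to a functional that is not bundled as a linear map, as
happens for the restriction to e₆ of the Killing form of e₈. -/
theorem form6_unique_of_vee6 (φ : e6) (c : ℂ) (f : e6 → ℂ) (hadd : ∀ a b, f (a + b) = f a + f b)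
    (hsmul : ∀ (z : ℂ) a, f (z • a) = z * f a) (h : ∀ X W, f (vee6 X W) = c * ip (φ.1 X) W)
    (ψ : e6) : f ψ = c * form6 φ ψ :=
  form6_unique φ c { toFun := f, map_add' := hadd, map_smul' := hsmul } h ψ

/-- The Lie algebra `e₇` as a type of its own, for which instances are found quickly. -/
def E7 : Type := e7

noncomputable instance : LieRing E7 := (inferInstance : LieRing e7)

noncomputable instance : LieAlgebra ℂ E7 := (inferInstance : LieAlgebra ℂ e7)

instance : Module.Finite ℂ E7 := inferInstanceAs (Module.Finite ℂ e7)

/-- `Φ(φ, A, B, ν)` as an element of `e₇`. -/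
noncomputable def mk7 (φ : e6) (A B : JH) (ν : ℂ) : E7 := ⟨Phi φ.1 A B ν, Phi_mem φ.2 A B ν⟩

theorem exists_mk7 (Φ : E7) : ∃ φ A B ν, Φ = mk7 φ A B ν := by
  obtain ⟨_, φ, h, A, B, ν, rfl⟩ := Φ
  exact ⟨⟨φ, h⟩, A, B, ν, rfl⟩

theorem mk7_add (φ φ' : e6) (A A' B B' : JH) (ν ν' : ℂ) :
    mk7 φ A B ν + mk7 φ' A' B' ν' = mk7 (φ + φ') (A + A') (B + B') (ν + ν') :=
  Subtype.ext (Phi_add ..)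

theorem mk7_smul (c : ℂ) (φ : e6) (A B : JH) (ν : ℂ) :
    c • mk7 φ A B ν = mk7 (c • φ) (c • A) (c • B) (c * ν) :=
  Subtype.ext (Phi_smul ..)

theorem lie_mk7 (φ φ' : e6) (A A' B B' : JH) (ν ν' : ℂ) :
    ⁅mk7 φ A B ν, mk7 φ' A' B' ν'⁆ =
      mk7 (⁅φ, φ'⁆ + (2 : ℂ) • vee6 A B' - (2 : ℂ) • vee6 A' B)
        (φ.1 A' - φ'.1 A + (2 / 3 * ν) • A' - (2 / 3 * ν') • A)
        (transp φ'.1 B - transp φ.1 B' - (2 / 3 * ν) • B' + (2 / 3 * ν') • B)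
        (ip A B' - ip A' B) :=
  Subtype.ext (lie_Phi φ.2 φ'.2 ..)

/-- The inclusion `A ↦ Φ(0, A, 0, 0)`. -/
noncomputable def inA : JH →ₗ[ℂ] E7 where
  toFun A := mk7 0 A 0 0
  map_add' A A' := by rw [mk7_add, add_zero, add_zero, add_zero]
  map_smul' c A := by rw [RingHom.id_apply, mk7_smul, smul_zero, smul_zero, mul_zero]

/-- The inclusion `B ↦ Φ(0, 0, B, 0)`. -/
noncomputable def inB : JH →ₗ[ℂ] E7 where
  toFun B := mk7 0 0 B 0
  map_add' A A' := by rw [mk7_add, add_zero, add_zero, add_zero]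
  map_smul' c A := by rw [RingHom.id_apply, mk7_smul, smul_zero, smul_zero, mul_zero]

/-- The inclusion `φ ↦ Φ(φ, 0, 0, 0)`. -/
noncomputable def in6 : e6 →ₗ[ℂ] E7 where
  toFun φ := mk7 φ 0 0 0
  map_add' A A' := by rw [mk7_add, add_zero, add_zero]
  map_smul' c A := by rw [RingHom.id_apply, mk7_smul, smul_zero, mul_zero]

/-- The grading element `Φ(0, 0, 0, 1)`. -/
noncomputable def grad7 : E7 := mk7 0 0 0 1

theorem in6_apply (φ : e6) : in6 φ = mk7 φ 0 0 0 := rfl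

theorem inA_apply (A : JH) : inA A = mk7 0 A 0 0 := rfl

theorem inB_apply (B : JH) : inB B = mk7 0 0 B 0 := rfl

theorem grad7_def : grad7 = mk7 0 0 0 1 := rfl

/-- The underlying endomorphism of `𝔓`. -/
noncomputable def E7.val (Φ : E7) : Module.End ℂ PH := Subtype.val (p := (· ∈ e7)) Φ

theorem val_mk7 (φ : e6) (A B : JH) (ν : ℂ) : (mk7 φ A B ν).val = Phi φ.1 A B ν := rfl

/-- `P × Q` as an element of `E7`. -/
noncomputable def pc7 (P Q : PH) : E7 := pc P Q

theorem pc7_eq_mk7 (X Y Z W : JH) (ξ η ζ ω : ℂ) : pc7 (X, Y, ξ, η) (Z, W, ζ, ω) =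
    mk7 (-(1 / 2 : ℂ) • (vee6 X W + vee6 Z Y))
      (-(1 / 4 : ℂ) • ((2 : ℂ) • cross Y W - ξ • Z - ζ • X))
      ((1 / 4 : ℂ) • ((2 : ℂ) • cross X Z - η • W - ω • Y))
      (1 / 8 * (ip X W + ip Z Y - 3 * (ξ * ω + ζ * η))) := rfl

theorem form7_mk7 (φ φ' : e6) (A A' B B' : JH) (ν ν' : ℂ) :
    form7 (mk7 φ A B ν) (mk7 φ' A' B' ν') =
      -2 * form6 φ φ' - 4 * ip A B' - 4 * ip A' B - 8 / 3 * (ν * ν') :=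
  form7_Phi φ.2 φ'.2 ..

/-- The projection `Φ(φ, A, B, ν) ↦ A`. -/
noncomputable def prA : E7 →ₗ[ℂ] JH where
  toFun Φ := APart Φ.val
  map_add' _ _ := rfl
  map_smul' _ _ := rfl

/-- The projection `Φ(φ, A, B, ν) ↦ B`. -/
noncomputable def prB : E7 →ₗ[ℂ] JH where
  toFun Φ := BPart Φ.val
  map_add' _ _ := rfl
  map_smul' _ _ := rfl

theorem prA_mk7 (φ : e6) (A B : JH) (ν : ℂ) : prA (mk7 φ A B ν) = A := APart_Phi ..

theorem prB_mk7 (φ : e6) (A B : JH) (ν : ℂ) : prB (mk7 φ A B ν) = B := BPart_Phi ..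

theorem coe_zero_e6 : ((0 : e6) : Module.End ℂ JH) = 0 := rfl

theorem vee6_zero_left (W : JH) : vee6 0 W = 0 := by
  apply Subtype.ext
  have := vee_smul_left 0 0 W
  rwa [zero_smul, zero_smul] at this

theorem vee6_zero_right (W : JH) : vee6 W 0 = 0 := by
  apply Subtype.ext
  have := vee_smul_right 0 W 0
  rwa [zero_smul, zero_smul] at this

attribute [irreducible] mk7 grad7 in6 inA inB prA prB

theorem mk7_eq (φ : e6) (A B : JH) (ν : ℂ) :
    mk7 φ A B ν = in6 φ + inA A + inB B + ν • grad7 := by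
  rw [in6_apply, inA_apply, inB_apply, grad7_def, mk7_smul, mk7_add, mk7_add, mk7_add]
  congr 1 <;> simp

theorem transp_zero : transp 0 = 0 := by
  have := transp_smul 0 0
  simpa using this

/-! ### The three-term grading of e₇ -/

theorem grad7_lie (φ : e6) (A B : JH) (ν : ℂ) : ⁅grad7, mk7 φ A B ν⁆ =
    mk7 0 ((2 / 3 : ℂ) • A) ((-(2 / 3) : ℂ) • B) 0 := by
  rw [grad7_def, lie_mk7]
  congr 1
  · rw [zero_lie, vee6_zero_left, vee6_zero_right]; simp
  · rw [coe_zero_e6]; simp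
  · rw [coe_zero_e6, transp_zero]; simp only [map_zero, LinearMap.zero_apply]; module
  · simp

theorem grad7_lie_inA (A : JH) : ⁅grad7, inA A⁆ = (2 / 3 : ℂ) • inA A := by
  rw [inA_apply, grad7_lie, mk7_smul, smul_zero, smul_zero, smul_zero, mul_zero]

theorem grad7_lie_inB (B : JH) : ⁅grad7, inB B⁆ = (-(2 / 3) : ℂ) • inB B := by
  rw [inB_apply, grad7_lie, mk7_smul, smul_zero, smul_zero, smul_zero, mul_zero]

theorem grad7_lie_in6 (φ : e6) : ⁅grad7, in6 φ⁆ = (0 : ℂ) • in6 φ := by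
  rw [in6_apply, grad7_lie, mk7_smul, smul_zero, smul_zero, smul_zero, mul_zero, zero_smul]

theorem grad7_lie_self : ⁅grad7, grad7⁆ = (0 : ℂ) • grad7 := by
  have h := grad7_lie 0 0 0 1
  rw [← grad7_def, smul_zero, smul_zero] at h
  rw [h, grad7_def, mk7_smul, smul_zero, smul_zero, zero_mul]

theorem lie_in6_inA (φ : e6) (A : JH) : ⁅in6 φ, inA A⁆ = inA (φ.1 A) := by
  rw [in6_apply, inA_apply, inA_apply, lie_mk7]
  congr 1
  · rw [lie_zero, vee6_zero_left, vee6_zero_right]; simp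
  · simp
  · simp
  · simp

/-- The extreme weight spaces bracket onto generators of e₆ plus a multiple of the grading element.
Through this relation the A–B pairing and the pairing on e₆ are both derived from traces against
`grad7`. -/
theorem lie_inA_inB (A B : JH) : ⁅inA A, inB B⁆ = (2 : ℂ) • in6 (vee6 A B) + ip A B • grad7 := by
  have h : (2 : ℂ) • in6 (vee6 A B) + ip A B • grad7 = mk7 ((2 : ℂ) • vee6 A B) 0 0 (ip A B) := by
    rw [mk7_eq, map_smul, map_zero, map_zero, add_zero, add_zero]
  rw [h, inA_apply, inB_apply, lie_mk7]
  congr 1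
  · rw [lie_zero, vee6_zero_left]; simp
  · rw [coe_zero_e6]; simp
  · rw [coe_zero_e6, transp_zero]; simp
  · simp

/-- The outer bracket kills the e₆- and ν-components, so only the blocks on A and B remain. On B
both brackets carry a minus sign, hence the equal signs in the result. -/
theorem lie_grad7_lie (φ φ' : e6) (A B : JH) (ν ν' : ℂ) :
    ⁅grad7, ⁅mk7 φ 0 0 ν, mk7 φ' A B ν'⁆⁆ =
      inA ((2 / 3 : ℂ) • (φ.1 A + (2 / 3 * ν) • A))
      + inB ((2 / 3 : ℂ) • (transp φ.1 B + (2 / 3 * ν) • B)) := by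
  rw [lie_mk7, grad7_lie, inA_apply, inB_apply, mk7_add]
  congr 1
  · simp
  · simp
  · rw [map_zero]; module
  · simp

/-- Each of the two 15-dimensional blocks contributes (2/3)(2/3)ν · 15 = 20ν/3; φ and its transpose
contribute nothing, being traceless. -/
theorem killingForm_grad7_mk7 (φ : e6) (ν : ℂ) :
    killingForm ℂ E7 grad7 (mk7 φ 0 0 ν) = 40 / 3 * ν := by
  have key : (LieAlgebra.ad ℂ E7 grad7) ∘ₗ (LieAlgebra.ad ℂ E7 (mk7 φ 0 0 ν)) =
      inA ∘ₗ ((2 / 3 : ℂ) • (φ.1 + (2 / 3 * ν) • LinearMap.id)) ∘ₗ prA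
      + inB ∘ₗ ((2 / 3 : ℂ) • (transp φ.1 + (2 / 3 * ν) • LinearMap.id)) ∘ₗ prB := by
    refine LinearMap.ext fun Φ => ?_
    obtain ⟨φ', A, B, ν', h⟩ := exists_mk7 Φ
    have hA : prA Φ = A := by rw [h, prA_mk7]
    have hB : prB Φ = B := by rw [h, prB_mk7]
    have hl := lie_grad7_lie φ φ' A B ν ν'
    rw [← h, ← hA, ← hB] at hl
    exact hl
  have trace_eq : ∀ f : Module.End ℂ JH, LinearMap.trace ℂ JH f = 0 →
      LinearMap.trace ℂ JH ((2 / 3 : ℂ) • (f + (2 / 3 * ν) • LinearMap.id)) = 20 / 3 * ν := by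
    intro f hf
    rw [map_smul, map_add, map_smul, LinearMap.trace_id, finrank_JH, hf, smul_eq_mul, smul_eq_mul]
    push_cast
    ring
  rw [killingForm_apply_apply, key, map_add,
    trace_conj_of_leftInverse inA prA fun A => by rw [inA_apply, prA_mk7],
    trace_conj_of_leftInverse inB prB fun A => by rw [inB_apply, prB_mk7],
    trace_eq _ (trace_e6 φ.2), trace_eq _ (trace_e6 (transp_mem φ.2))]
  ring

theorem killingForm_grad7_grad7 : killingForm ℂ E7 grad7 grad7 = 40 / 3 := by
  have := killingForm_grad7_mk7 0 1
  rwa [← grad7_def, mul_one] at this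

theorem killingForm_grad7_in6 (φ : e6) : killingForm ℂ E7 grad7 (in6 φ) = 0 := by
  have := killingForm_grad7_mk7 φ 0
  rwa [← in6_apply, mul_zero] at this

/-- The weight 2/3 of `inA A` turns this into a pairing of `grad7` with `[inA A, inB B]`, where only
the multiple of `grad7` counts: 20 = (3/2)(40/3). -/
theorem killingForm_inA_inB (A B : JH) : killingForm ℂ E7 (inA A) (inB B) = 20 * ip A B := by
  have h := mul_killingForm_of_lie_eq (grad7_lie_inA A) (inB B)
  rw [lie_inA_inB, map_add, map_smul, map_smul, killingForm_grad7_in6, killingForm_grad7_grad7,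
    smul_eq_mul, smul_eq_mul] at h
  linear_combination (3 / 2 : ℂ) * h

theorem killingForm_in6_in6 (φ ψ : e6) :
    killingForm ℂ E7 (in6 φ) (in6 ψ) = 10 * form6 φ ψ := by
  refine form6_unique φ 10 (killingForm ℂ E7 (in6 φ) ∘ₗ in6) (fun X W => ?_) ψ
  -- Invariance moves φ onto X. Expanding the same bracket gives twice the pairing with X ∨ W, since
  -- `grad7` is orthogonal to e₆.
  have h1 : killingForm ℂ E7 (in6 φ) ⁅inA X, inB W⁆ = 20 * ip (φ.1 X) W := by
    rw [← killingForm_lie_apply, lie_in6_inA, killingForm_inA_inB]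
  rw [lie_inA_inB, map_add, map_smul, map_smul, killingForm_comm (in6 φ) grad7,
    killingForm_grad7_in6, smul_zero, add_zero, smul_eq_mul] at h1
  change killingForm ℂ E7 (in6 φ) (in6 (vee6 X W)) = _
  linear_combination (1 / 2 : ℂ) * h1

/-- The Killing form of `e₇` is `-5 ( , )_7`. -/
theorem killingForm_e7 (Φ Ψ : e7) : killingForm ℂ e7 Φ Ψ = -5 * form7 Φ Ψ := by
  change killingForm ℂ E7 Φ Ψ = _
  obtain ⟨φ, A, B, ν, rfl⟩ := exists_mk7 Φ
  obtain ⟨φ', A', B', ν', rfl⟩ := exists_mk7 Ψ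
  rw [form7_mk7, mk7_eq, mk7_eq]
  -- These are the pairs whose weights, taken from 2/3, -2/3, 0, do not cancel. The orthogonality of
  -- `grad7` and e₆, both of weight 0, comes from the trace computation instead.
  have z1 := fun A φ => killingForm_eq_zero_of_lie_eq (grad7_lie_inA A) (grad7_lie_in6 φ)
    (by norm_num)
  have z2 := fun B φ => killingForm_eq_zero_of_lie_eq (grad7_lie_inB B) (grad7_lie_in6 φ)
    (by norm_num)
  have z3 := fun A => killingForm_eq_zero_of_lie_eq (grad7_lie_inA A) grad7_lie_self (by norm_num)
  have z4 := fun B => killingForm_eq_zero_of_lie_eq (grad7_lie_inB B) grad7_lie_self (by norm_num)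
  have z5 := fun A A' => killingForm_eq_zero_of_lie_eq (grad7_lie_inA A) (grad7_lie_inA A')
    (by norm_num)
  have z6 := fun B B' => killingForm_eq_zero_of_lie_eq (grad7_lie_inB B) (grad7_lie_inB B')
    (by norm_num)
  simp only [map_add, map_smul, LinearMap.add_apply, LinearMap.smul_apply, smul_eq_mul,
    killingForm_comm (in6 φ) (inA A'), killingForm_comm (in6 φ) (inB B'),
    killingForm_comm (in6 φ) grad7, killingForm_comm grad7 (inA A'),
    killingForm_comm grad7 (inB B'), killingForm_comm (inB B) (inA A'), z1, z2, z3, z4, z5, z6,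
    killingForm_grad7_in6, killingForm_grad7_grad7, killingForm_inA_inB, killingForm_in6_in6]
  ring

theorem finrank_PH : Module.finrank ℂ PH = 32 := by
  simp [finrank_JH]

namespace E8

/-! ### The Killing form of `e₈` -/

theorem finite_E8 : Module.Finite ℂ E8 :=
  have : Module.Finite ℂ (E7 × PH × PH × ℂ × ℂ × ℂ) := inferInstance
  have : Module.Finite ℂ (e7 × PH × PH × ℂ × ℂ × ℂ) := this
  Module.Finite.equiv (equivProd.linearEquiv ℂ).symm

/-- The Lie algebra `e₈` with the additive structure that comes from its Lie ring structure as the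
only one, so that instances are found quickly. -/
def G8 : Type := E8

noncomputable instance : LieRing G8 := (inferInstance : LieRing E8)

noncomputable instance : LieAlgebra ℂ G8 := (inferInstance : LieAlgebra ℂ E8)

instance : Module.Finite ℂ G8 := finite_E8

/-- The element `(Φ, P, Q, r, s, t)`. -/
def mk8 (Φ : E7) (P Q : PH) (r s t : ℂ) : G8 := E8.mk Φ P Q r s t

theorem exists_mk8 (R : G8) : ∃ Φ P Q r s t, R = mk8 Φ P Q r s t :=
  ⟨E8.Φ R, E8.P R, E8.Q R, E8.r R, E8.s R, E8.t R, rfl⟩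

theorem mk8_add (Φ Φ' : E7) (P P' Q Q' : PH) (r r' s s' t t' : ℂ) :
    mk8 Φ P Q r s t + mk8 Φ' P' Q' r' s' t' =
      mk8 (Φ + Φ') (P + P') (Q + Q') (r + r') (s + s') (t + t') := rfl

theorem mk8_smul (c : ℂ) (Φ : E7) (P Q : PH) (r s t : ℂ) :
    c • mk8 Φ P Q r s t = mk8 (c • Φ) (c • P) (c • Q) (c * r) (c * s) (c * t) := rfl

theorem mk8_zero : mk8 0 0 0 0 0 0 = 0 := rfl

theorem lie_mk (Φ Φ' : e7) (P P' Q Q' : PH) (r r' s s' t t' : ℂ) :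
    ⁅E8.mk Φ P Q r s t, E8.mk Φ' P' Q' r' s' t'⁆ =
      E8.mk (⁅Φ, Φ'⁆ + pc P Q' - pc P' Q)
        (Φ.1 P' - Φ'.1 P + r • P' - r' • P + s • Q' - s' • Q)
        (Φ.1 Q' - Φ'.1 Q - r • Q' + r' • Q + t • P' - t' • P)
        (-(1 / 8) * skew P Q' + 1 / 8 * skew P' Q + s * t' - s' * t)
        (1 / 4 * skew P P' + 2 * r * s' - 2 * r' * s)
        (-(1 / 4) * skew Q Q' - 2 * r * t' + 2 * r' * t) :=
  by rw [lie_def]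

theorem G8.lie_eq (R S : G8) : ⁅R, S⁆ = Bracket.bracket (L := E8) (M := E8) R S := rfl

theorem E7.lie_add_sub (Φ Ψ A B : E7) :
    ⁅Φ, Ψ⁆ + A - B = HSub.hSub (α := e7) (β := e7) (γ := e7)
      (HAdd.hAdd (α := e7) (β := e7) (γ := e7) (Bracket.bracket (L := e7) (M := e7) Φ Ψ) A) B := rfl

theorem lie_mk8 (Φ Φ' : E7) (P P' Q Q' : PH) (r r' s s' t t' : ℂ) :
    ⁅mk8 Φ P Q r s t, mk8 Φ' P' Q' r' s' t'⁆ =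
      mk8 (⁅Φ, Φ'⁆ + pc7 P Q' - pc7 P' Q)
        (Φ.val P' - Φ'.val P + r • P' - r' • P + s • Q' - s' • Q)
        (Φ.val Q' - Φ'.val Q - r • Q' + r' • Q + t • P' - t' • P)
        (-(1 / 8) * skew P Q' + 1 / 8 * skew P' Q + s * t' - s' * t)
        (1 / 4 * skew P P' + 2 * r * s' - 2 * r' * s)
        (-(1 / 4) * skew Q Q' - 2 * r * t' + 2 * r' * t) :=
  by
  have h1 := G8.lie_eq (mk8 Φ P Q r s t) (mk8 Φ' P' Q' r' s' t')
  have h2 := E7.lie_add_sub Φ Φ' (pc7 P Q') (pc7 P' Q)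
  rw [h1, h2]
  unfold mk8 pc7 E7.val
  exact lie_mk Φ Φ' P P' Q Q' r r' s s' t t'

theorem form8_mk8 (Φ Φ' : E7) (P P' Q Q' : PH) (r r' s s' t t' : ℂ) :
    form8 (mk8 Φ P Q r s t) (mk8 Φ' P' Q' r' s' t') =
      form7 Φ Φ' - skew Q P' + skew P Q' - 8 * (r * r') - 4 * (t * s') - 4 * (s * t') := rfl

theorem val_zero : (0 : E7).val = 0 := rfl

theorem pc7_zero_left (Q : PH) : pc7 0 Q = 0 := by
  apply Subtype.ext
  have := pcross_smul_left 0 0 Q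
  rwa [zero_smul, zero_smul] at this

theorem pc7_zero_right (P : PH) : pc7 P 0 = 0 := by
  apply Subtype.ext
  have := pcross_smul_right 0 P 0
  rwa [zero_smul, zero_smul] at this

theorem skew_zero_left (Q : PH) : skew 0 Q = 0 := by
  have := skew_smul_left 0 0 Q
  rwa [zero_smul, zero_mul] at this

theorem skew_zero_right (P : PH) : skew P 0 = 0 := by
  rw [skew_comm, skew_zero_left, neg_zero]

/-- The inclusion of `e₇`. -/
noncomputable def inPhi : E7 →ₗ[ℂ] G8 where
  toFun Φ := mk8 Φ 0 0 0 0 0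
  map_add' _ _ := by simp only [mk8_add, add_zero]
  map_smul' _ _ := by simp only [mk8_smul, smul_zero, mul_zero, RingHom.id_apply, smul_eq_mul]

theorem inPhi_apply (Φ : E7) : inPhi Φ = mk8 Φ 0 0 0 0 0 := rfl

/-- The inclusion of the first summand `𝔓`. -/
noncomputable def inP : PH →ₗ[ℂ] G8 where
  toFun P := mk8 0 P 0 0 0 0
  map_add' _ _ := by simp only [mk8_add, add_zero]
  map_smul' _ _ := by simp only [mk8_smul, smul_zero, mul_zero, RingHom.id_apply, smul_eq_mul]

theorem inP_apply (P : PH) : inP P = mk8 0 P 0 0 0 0 := rfl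

/-- The inclusion of the second summand `𝔓`. -/
noncomputable def inQ : PH →ₗ[ℂ] G8 where
  toFun Q := mk8 0 0 Q 0 0 0
  map_add' _ _ := by simp only [mk8_add, add_zero]
  map_smul' _ _ := by simp only [mk8_smul, smul_zero, mul_zero, RingHom.id_apply, smul_eq_mul]

theorem inQ_apply (Q : PH) : inQ Q = mk8 0 0 Q 0 0 0 := rfl

/-- The inclusion of the coordinate `r`. -/
noncomputable def inR : ℂ →ₗ[ℂ] G8 where
  toFun r := mk8 0 0 0 r 0 0
  map_add' _ _ := by simp only [mk8_add, add_zero]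
  map_smul' _ _ := by simp only [mk8_smul, smul_zero, mul_zero, RingHom.id_apply, smul_eq_mul]

theorem inR_apply (r : ℂ) : inR r = mk8 0 0 0 r 0 0 := rfl

/-- The inclusion of the coordinate `s`. -/
noncomputable def inS : ℂ →ₗ[ℂ] G8 where
  toFun s := mk8 0 0 0 0 s 0
  map_add' _ _ := by simp only [mk8_add, add_zero]
  map_smul' _ _ := by simp only [mk8_smul, smul_zero, mul_zero, RingHom.id_apply, smul_eq_mul]

theorem inS_apply (s : ℂ) : inS s = mk8 0 0 0 0 s 0 := rfl

/-- The inclusion of the coordinate `t`. -/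
noncomputable def inT : ℂ →ₗ[ℂ] G8 where
  toFun t := mk8 0 0 0 0 0 t
  map_add' _ _ := by simp only [mk8_add, add_zero]
  map_smul' _ _ := by simp only [mk8_smul, smul_zero, mul_zero, RingHom.id_apply, smul_eq_mul]

theorem inT_apply (t : ℂ) : inT t = mk8 0 0 0 0 0 t := rfl

/-- The projection to the first summand `𝔓`. -/
noncomputable def prP : G8 →ₗ[ℂ] PH where
  toFun R := E8.P R
  map_add' _ _ := rfl
  map_smul' _ _ := rfl

theorem prP_mk8 (Φ : E7) (P Q : PH) (r s t : ℂ) : prP (mk8 Φ P Q r s t) = P := rfl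

/-- The projection to the second summand `𝔓`. -/
noncomputable def prQ : G8 →ₗ[ℂ] PH where
  toFun R := E8.Q R
  map_add' _ _ := rfl
  map_smul' _ _ := rfl

theorem prQ_mk8 (Φ : E7) (P Q : PH) (r s t : ℂ) : prQ (mk8 Φ P Q r s t) = Q := rfl

/-- The projection to the coordinate `s`. -/
noncomputable def prS : G8 →ₗ[ℂ] ℂ where
  toFun R := E8.s R
  map_add' _ _ := rfl
  map_smul' _ _ := rfl

theorem prS_mk8 (Φ : E7) (P Q : PH) (r s t : ℂ) : prS (mk8 Φ P Q r s t) = s := rfl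

/-- The projection to the coordinate `t`. -/
noncomputable def prT : G8 →ₗ[ℂ] ℂ where
  toFun R := E8.t R
  map_add' _ _ := rfl
  map_smul' _ _ := rfl

theorem prT_mk8 (Φ : E7) (P Q : PH) (r s t : ℂ) : prT (mk8 Φ P Q r s t) = t := rfl

attribute [irreducible] mk8 inPhi inP inQ inR inS inT prP prQ prS prT
attribute [local irreducible] E7.val pc7

theorem mk8_eq (Φ : E7) (P Q : PH) (r s t : ℂ) :
    mk8 Φ P Q r s t = inPhi Φ + inP P + inQ Q + inR r + inS s + inT t := by
  simp only [inPhi_apply, inP_apply, inQ_apply, inR_apply, inS_apply, inT_apply, mk8_add, add_zero,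
    zero_add]

/-- `[inR 1, R]` multiplies `P, Q, s, t` by `1, -1, 2, -2` and kills `Φ` and `r`. -/
theorem inR_one_lie (Φ : E7) (P Q : PH) (r s t : ℂ) :
    ⁅inR 1, mk8 Φ P Q r s t⁆ = mk8 0 P (-Q) 0 (2 * s) (-2 * t) := by
  rw [inR_apply, lie_mk8]
  congr 1 <;> simp [pc7_zero_left, pc7_zero_right, skew_zero_left, skew_zero_right, val_zero]

theorem inR_one_lie_lie (Φ : E7) (P Q : PH) (r s t : ℂ) :
    ⁅inR 1, ⁅inR 1, mk8 Φ P Q r s t⁆⁆ =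
      inP P + inQ Q + inS ((4 : ℂ) • s) + inT ((4 : ℂ) • t) := by
  have h1 : 2 * (2 * s) = 4 * s := by ring
  have h2 : -2 * (-2 * t) = 4 * t := by ring
  rw [inR_one_lie, inR_one_lie, mk8_eq, map_zero inPhi, map_zero inR, zero_add, add_zero, neg_neg,
    h1, h2, smul_eq_mul, smul_eq_mul]

/-- The square of the adjoint action is 1 on each of the two 32-dimensional summands, 4 on the s-
and t-lines, and 0 elsewhere: 32 + 32 + 4 + 4. It is the only trace evaluated in e₈. -/
theorem killingForm_inR_inR : killingForm ℂ G8 (inR 1) (inR 1) = 72 := by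
  have key : (LieAlgebra.ad ℂ G8 (inR 1)) ∘ₗ (LieAlgebra.ad ℂ G8 (inR 1)) =
      inP ∘ₗ LinearMap.id ∘ₗ prP + inQ ∘ₗ LinearMap.id ∘ₗ prQ
      + inS ∘ₗ ((4 : ℂ) • LinearMap.id) ∘ₗ prS + inT ∘ₗ ((4 : ℂ) • LinearMap.id) ∘ₗ prT := by
    refine LinearMap.ext fun R => ?_
    obtain ⟨Φ, P, Q, r, s, t, h⟩ := exists_mk8 R
    have hl := inR_one_lie_lie Φ P Q r s t
    have hP : prP R = P := by rw [h, prP_mk8]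
    have hQ : prQ R = Q := by rw [h, prQ_mk8]
    have hs : prS R = s := by rw [h, prS_mk8]
    have ht : prT R = t := by rw [h, prT_mk8]
    rw [← h, ← hP, ← hQ, ← hs, ← ht] at hl
    simp only [LinearMap.add_apply, LinearMap.comp_apply, LieAlgebra.ad_apply, LinearMap.id_apply,
      LinearMap.smul_apply]
    exact hl
  rw [killingForm_apply_apply, key, map_add, map_add, map_add,
    trace_conj_of_leftInverse inP prP fun P => by rw [inP_apply, prP_mk8],
    trace_conj_of_leftInverse inQ prQ fun P => by rw [inQ_apply, prQ_mk8],
    trace_conj_of_leftInverse inS prS fun P => by rw [inS_apply, prS_mk8],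
    trace_conj_of_leftInverse inT prT fun P => by rw [inT_apply, prT_mk8],
    map_smul, LinearMap.trace_id, LinearMap.trace_id, finrank_PH, Module.finrank_self]
  norm_num

/-! ### Weight vectors of e₈ and their brackets -/

theorem inR_one_lie_inPhi (Φ : E7) : ⁅inR 1, inPhi Φ⁆ = (0 : ℂ) • inPhi Φ := by
  rw [inPhi_apply Φ, inR_one_lie, neg_zero, mul_zero, mul_zero, zero_smul, mk8_zero]

theorem inR_one_lie_inR (r : ℂ) : ⁅inR 1, inR r⁆ = (0 : ℂ) • inR r := by
  rw [inR_apply r, inR_one_lie, neg_zero, mul_zero, mul_zero, zero_smul, mk8_zero]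

theorem inR_one_lie_inP (P : PH) : ⁅inR 1, inP P⁆ = (1 : ℂ) • inP P := by
  rw [inP_apply P, inR_one_lie, neg_zero, mul_zero, mul_zero, one_smul]

theorem inR_one_lie_inQ (Q : PH) : ⁅inR 1, inQ Q⁆ = (-1 : ℂ) • inQ Q := by
  rw [← map_smul, inQ_apply Q, inQ_apply, inR_one_lie, mul_zero, mul_zero]
  congr 1
  module

theorem inR_one_lie_inS (s : ℂ) : ⁅inR 1, inS s⁆ = (2 : ℂ) • inS s := by
  rw [← map_smul, inS_apply s, inS_apply, inR_one_lie, neg_zero, mul_zero, smul_eq_mul]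

theorem inR_one_lie_inT (t : ℂ) : ⁅inR 1, inT t⁆ = (-2 : ℂ) • inT t := by
  rw [← map_smul, inT_apply t, inT_apply, inR_one_lie, neg_zero, mul_zero, smul_eq_mul]

theorem lie_inS_inT (s t : ℂ) : ⁅inS s, inT t⁆ = (s * t) • inR 1 := by
  rw [inS_apply, inT_apply, inR_apply, lie_mk8, mk8_smul]
  congr 1 <;> simp [pc7_zero_left, pc7_zero_right, skew_zero_left, skew_zero_right, val_zero]

theorem lie_inT_inPhi (t : ℂ) (Φ : E7) : ⁅inT t, inPhi Φ⁆ = 0 := by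
  rw [inT_apply, inPhi_apply, lie_mk8, ← mk8_zero]
  congr 1 <;> simp [pc7_zero_left, pc7_zero_right, skew_zero_left, skew_zero_right, val_zero]

theorem lie_inP_inQ (P Q : PH) :
    ⁅inP P, inQ Q⁆ = inPhi (pc7 P Q) + (-(1 / 8) * skew P Q) • inR 1 := by
  rw [inP_apply, inQ_apply, inPhi_apply, inR_apply, lie_mk8, mk8_smul, mk8_add]
  congr 1 <;> simp [pc7_zero_left, pc7_zero_right, skew_zero_left, skew_zero_right, val_zero]

theorem lie_inPhi_inP (Φ : E7) (P : PH) : ⁅inPhi Φ, inP P⁆ = inP (Φ.val P) := by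
  rw [inPhi_apply, inP_apply, inP_apply, lie_mk8]
  congr 1 <;> simp [pc7_zero_left, pc7_zero_right, skew_zero_left, skew_zero_right, val_zero]

/-! ### Pairings in e₈ obtained from invariance -/

/-- Both vectors have weight 0, so weights decide nothing. Instead `inR 1` is the bracket of `inS 1`
and `inT 1`, and the latter commutes with e₇. -/
theorem killingForm_inR_inPhi (Φ : E7) : killingForm ℂ G8 (inR 1) (inPhi Φ) = 0 := by
  have h := lie_inS_inT 1 1
  rw [mul_one, one_smul] at h
  rw [← h, killingForm_lie_apply, lie_inT_inPhi, map_zero]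

theorem killingForm_inS_inT (s t : ℂ) : killingForm ℂ G8 (inS s) (inT t) = 36 * (s * t) := by
  have h := mul_killingForm_of_lie_eq (inR_one_lie_inS s) (inT t)
  rw [lie_inS_inT, map_smul, killingForm_inR_inR, smul_eq_mul] at h
  linear_combination (1 / 2 : ℂ) * h

/-- As `inP P` has weight 1, the value is that of `inR 1` against `[P, Q]`. The e₇-part P × Q drops
out and the r-part gives 72 · (-1/8) = -9. -/
theorem killingForm_inP_inQ (P Q : PH) : killingForm ℂ G8 (inP P) (inQ Q) = -9 * skew P Q := by
  have h := mul_killingForm_of_lie_eq (inR_one_lie_inP P) (inQ Q)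
  rw [lie_inP_inQ, map_add, map_smul, killingForm_inR_inR, killingForm_inR_inPhi, smul_eq_mul] at h
  linear_combination h

/-- P × Q is the e₇-part of `[P, Q]`, and the rest is orthogonal to e₇, so invariance transfers Φ
onto P. This computes the form on e₇ without tracing over e₈. -/
theorem killingForm_inPhi_pc (Φ : E7) (P Q : PH) :
    killingForm ℂ G8 (inPhi Φ) (inPhi (pc7 P Q)) = -9 * skew (Φ.val P) Q := by
  have h : killingForm ℂ G8 (inPhi Φ) ⁅inP P, inQ Q⁆ = -9 * skew (Φ.val P) Q := by
    rw [← killingForm_lie_apply, lie_inPhi_inP, killingForm_inP_inQ]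
  rwa [lie_inP_inQ, map_add, map_smul, killingForm_comm (inPhi Φ) (inR 1), killingForm_inR_inPhi,
    smul_zero, add_zero] at h

/-! ### Generators of e₇ as Freudenthal cross products -/

/-- Here and for the next generators, the scalars 4, -4, -8/3, -2 invert the coefficients 1/4, -1/4,
-3/8, -1/2 in the definition of P × Q. -/
theorem inA_eq_pc (A : JH) : inA A = pc7 (0, 0, 1, 0) ((4 : ℂ) • A, 0, 0, 0) := by
  rw [inA_apply, pc7_eq_mk7]
  congr 1
  · simp [vee6_zero_left, vee6_zero_right]
  · simp
  · simp
  · simp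

theorem inB_eq_pc (B : JH) : inB B = pc7 (0, 0, 0, 1) (0, (-4 : ℂ) • B, 0, 0) := by
  rw [inB_apply, pc7_eq_mk7]
  congr 1
  · simp [vee6_zero_left, vee6_zero_right]
  · simp
  · rw [map_zero]; module
  · simp

theorem grad7_eq_pc : grad7 = pc7 (0, 0, 1, 0) (0, 0, 0, -(8 / 3)) := by
  rw [grad7_def, pc7_eq_mk7]
  congr 1
  · simp [vee6_zero_left]
  · simp
  · simp
  · simp; norm_num

/-- The cross product chosen to produce X ∨ W also has ν-component -(X, W)/4, which the multiple of
`grad7` compensates. -/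
theorem in6_vee6_eq_pc (X W : JH) : in6 (vee6 X W) =
    pc7 (X, 0, 0, 0) (0, (-2 : ℂ) • W, 0, 0) + (1 / 4 * ip X W) • grad7 := by
  have h : vee6 X ((-2 : ℂ) • W) = (-2 : ℂ) • vee6 X W := Subtype.ext (vee_smul_right ..)
  rw [in6_apply, grad7_def, pc7_eq_mk7, mk7_smul, mk7_add, h, vee6_zero_left]
  congr 1
  · simp
  · simp
  · simp
  · simp; ring

theorem killingForm_inPhi_inA (φ : e6) (A B A' : JH) (ν : ℂ) :
    killingForm ℂ G8 (inPhi (mk7 φ A B ν)) (inPhi (inA A')) = 36 * ip A' B := by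
  rw [inA_eq_pc, killingForm_inPhi_pc, val_mk7, Phi_apply]
  simp [skew, ip_comm B]
  ring

theorem killingForm_inPhi_inB (φ : e6) (A B B' : JH) (ν : ℂ) :
    killingForm ℂ G8 (inPhi (mk7 φ A B ν)) (inPhi (inB B')) = 36 * ip A B' := by
  rw [inB_eq_pc, killingForm_inPhi_pc, val_mk7, Phi_apply]
  simp [skew]
  ring

theorem killingForm_inPhi_grad7 (φ : e6) (A B : JH) (ν : ℂ) :
    killingForm ℂ G8 (inPhi (mk7 φ A B ν)) (inPhi grad7) = 24 * ν := by
  rw [grad7_eq_pc, killingForm_inPhi_pc, val_mk7, Phi_apply]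
  simp [skew]
  ring

/-- The cross product contributes 18(φX, W) - 6ν(X, W), the second term coming from -νX/3 in the
action on 𝔓. The correction by `grad7` contributes 24ν · (X, W)/4 and cancels it. -/
theorem killingForm_inPhi_vee6 (φ : e6) (A B X W : JH) (ν : ℂ) :
    killingForm ℂ G8 (inPhi (mk7 φ A B ν)) (inPhi (in6 (vee6 X W))) = 18 * ip (φ.1 X) W := by
  rw [in6_vee6_eq_pc, map_add inPhi, map_smul inPhi, map_add, map_smul, killingForm_inPhi_grad7,
    killingForm_inPhi_pc, val_mk7, Phi_apply]
  simp [skew]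
  ring

theorem killingForm_inPhi_in6 (φ φ' : e6) (A B : JH) (ν : ℂ) :
    killingForm ℂ G8 (inPhi (mk7 φ A B ν)) (inPhi (in6 φ')) = 18 * form6 φ φ' := by
  refine form6_unique_of_vee6 φ 18 (fun ψ => killingForm ℂ G8 (inPhi (mk7 φ A B ν)) (inPhi (in6 ψ)))
    (fun a b => ?_) (fun c a => ?_) (fun X W => killingForm_inPhi_vee6 φ A B X W ν) φ'
  · simp only [map_add]
  · simp only [map_smul, smul_eq_mul]

theorem killingForm_inPhi_inPhi (Φ Ψ : E7) :
    killingForm ℂ G8 (inPhi Φ) (inPhi Ψ) = -9 * form7 Φ Ψ := by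
  obtain ⟨φ, A, B, ν, rfl⟩ := exists_mk7 Φ
  obtain ⟨φ', A', B', ν', rfl⟩ := exists_mk7 Ψ
  rw [form7_mk7, mk7_eq φ' A' B' ν']
  simp only [map_add, map_smul, killingForm_inPhi_inA, killingForm_inPhi_inB,
    killingForm_inPhi_grad7, killingForm_inPhi_in6, smul_eq_mul]
  ring

/-- The Killing form of `e₈` is `-9 ( , )_8`. -/
theorem killingForm_eq (R₁ R₂ : E8) : killingForm ℂ E8 R₁ R₂ = -9 * form8 R₁ R₂ := by
  change killingForm ℂ G8 R₁ R₂ = _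
  -- The weights 0, 0, 1, -1, 2, -2 leave only the pairings within e₇ and the r-line, of P with Q,
  -- and of s with t.
  have zero : ∀ {x y : G8} {a b : ℂ}, ⁅inR 1, x⁆ = a • x → ⁅inR 1, y⁆ = b • y → a + b ≠ 0 →
      killingForm ℂ G8 x y = 0 := killingForm_eq_zero_of_lie_eq
  have hr : ∀ r : ℂ, inR r = r • inR 1 := fun r => by rw [← map_smul, smul_eq_mul, mul_one]
  have hrr : ∀ r r' : ℂ, killingForm ℂ G8 (inR r) (inR r') = 72 * (r * r') := fun r r' => by
    rw [hr r, hr r', map_smul, map_smul, LinearMap.smul_apply, killingForm_inR_inR]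
    simp only [smul_eq_mul]
    ring
  have hrΦ : ∀ (r : ℂ) Φ, killingForm ℂ G8 (inR r) (inPhi Φ) = 0 := fun r Φ => by
    rw [hr r, map_smul, LinearMap.smul_apply, killingForm_inR_inPhi, smul_zero]
  have hΦP := fun Φ P => zero (inR_one_lie_inPhi Φ) (inR_one_lie_inP P) (by norm_num)
  have hΦQ := fun Φ Q => zero (inR_one_lie_inPhi Φ) (inR_one_lie_inQ Q) (by norm_num)
  have hΦs := fun Φ s => zero (inR_one_lie_inPhi Φ) (inR_one_lie_inS s) (by norm_num)
  have hΦt := fun Φ t => zero (inR_one_lie_inPhi Φ) (inR_one_lie_inT t) (by norm_num)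
  have hPr := fun P r => zero (inR_one_lie_inP P) (inR_one_lie_inR r) (by norm_num)
  have hQr := fun Q r => zero (inR_one_lie_inQ Q) (inR_one_lie_inR r) (by norm_num)
  have hsr := fun s r => zero (inR_one_lie_inS s) (inR_one_lie_inR r) (by norm_num)
  have htr := fun t r => zero (inR_one_lie_inT t) (inR_one_lie_inR r) (by norm_num)
  have hPP := fun P P' => zero (inR_one_lie_inP P) (inR_one_lie_inP P') (by norm_num)
  have hPs := fun P s => zero (inR_one_lie_inP P) (inR_one_lie_inS s) (by norm_num)
  have hPt := fun P t => zero (inR_one_lie_inP P) (inR_one_lie_inT t) (by norm_num)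
  have hQQ := fun Q Q' => zero (inR_one_lie_inQ Q) (inR_one_lie_inQ Q') (by norm_num)
  have hQs := fun Q s => zero (inR_one_lie_inQ Q) (inR_one_lie_inS s) (by norm_num)
  have hQt := fun Q t => zero (inR_one_lie_inQ Q) (inR_one_lie_inT t) (by norm_num)
  have hss := fun s s' => zero (inR_one_lie_inS s) (inR_one_lie_inS s') (by norm_num)
  have htt := fun t t' => zero (inR_one_lie_inT t) (inR_one_lie_inT t') (by norm_num)
  obtain ⟨Φ, P, Q, r, s, t, rfl⟩ := exists_mk8 R₁
  obtain ⟨Φ', P', Q', r', s', t', rfl⟩ := exists_mk8 R₂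
  rw [form8_mk8, mk8_eq, mk8_eq]
  -- Symmetry of κ puts each pair in the order treated above. For Q against P' this produces {P',
  -- Q}, and skew symmetry accounts for the opposite signs of the two 𝔓-terms.
  simp only [map_add, LinearMap.add_apply, hrr, hrΦ, hΦP, hΦQ, hΦs, hΦt, hPr, hQr, hsr, htr, hPP,
    hPs, hPt, hQQ, hQs, hQt, hss, htt, killingForm_inPhi_inPhi, killingForm_inP_inQ,
    killingForm_inS_inT, killingForm_comm (inPhi Φ) (inR r'), killingForm_comm (inP P) (inPhi Φ'),
    killingForm_comm (inQ Q) (inPhi Φ'), killingForm_comm (inQ Q) (inP P'),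
    killingForm_comm (inR r) (inP P'), killingForm_comm (inR r) (inQ Q'),
    killingForm_comm (inR r) (inS s'), killingForm_comm (inR r) (inT t'),
    killingForm_comm (inS s) (inPhi Φ'), killingForm_comm (inS s) (inP P'),
    killingForm_comm (inS s) (inQ Q'), killingForm_comm (inT t) (inPhi Φ'),
    killingForm_comm (inT t) (inP P'), killingForm_comm (inT t) (inQ Q'),
    killingForm_comm (inT t) (inS s'), skew_comm P' Q]
  ring

end E8

end QuatE8

theorem theorem8p1 (R₁ R₂ : QuatE8.E8) :
    killingForm ℂ QuatE8.E8 R₁ R₂ = -9 * QuatE8.E8.form8 R₁ R₂ ∧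
    killingForm ℂ QuatE8.E8 R₁ R₂ =
      -9 * QuatE8.form7 R₁.Φ R₂.Φ + 9 * QuatE8.skew R₁.Q R₂.P - 9 * QuatE8.skew R₁.P R₂.Q
        + 72 * (R₁.r * R₂.r) + 36 * (R₁.t * R₂.s) + 36 * (R₁.s * R₂.t) ∧
    killingForm ℂ QuatE8.E8 R₁ R₂ =
      9 / 5 * killingForm ℂ QuatE8.e7 R₁.Φ R₂.Φ + 9 * QuatE8.skew R₁.Q R₂.P
        - 9 * QuatE8.skew R₁.P R₂.Q
        + 72 * (R₁.r * R₂.r) + 36 * (R₁.t * R₂.s) + 36 * (R₁.s * R₂.t) := by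
  -- The last expression agrees with the second because (9/5)(-5) = -9.
  rw [QuatE8.killingForm_e7, QuatE8.E8.killingForm_eq, QuatE8.E8.form8]
  refine ⟨rfl, ?_, ?_⟩ <;> ring
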